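/- Let $n\in\mathbb N$ and let $\mathcal E_n$ be the $\mathbb R$-algebra of germs at $0$ of real $C^\infty$ functions on $\mathbb R^n$. For $f\in\mathcal E_n$ let $J(f)\subset\mathcal E_n$ be the ideal generated by $\partial f/\partial x_1,\dots,\partial f/\partial x_n$, and let $\mu(f)=\dim_{\mathbb R}\mathcal E_n/J(f)\in\mathbb N\cup\{+\infty\}$ be the real Milnor number of $f$; $f$ has an algebraically isolated singularity at $0$ if $\mu(f)<+\infty$. The initial part $\mathrm{in}(f)$ of $f$ at $0$ is the function $f_\alpha$, positively homogeneous of some degree $\alpha\ge 0$, such that $f_\alpha(x)/\|x\|^\alpha$ does not tend to $0$ and $(f(x)-f_\alpha(x))/\|x\|^\alpha\to 0$ as $x\to 0$ (if it exists, it is the nonzero homogeneous part of lowest degree of the Taylor series of $f$ at $0$). **Theorem.** Let $f,g\colon(\mathbb R^n,0)\to(\mathbb R,0)$ be germs of $C^\infty$ functions which have initial parts $\mathrm{in}(f)$ and $\mathrm{in}(g)$ at $0$, and suppose that $\mathrm{in}(f)$ and $\mathrm{in}(g)$ have algebraically isolated singularities at $0$. Suppose that $f$ and $g$ are $\mathcal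 R$-asymptotically Lipschitz equivalent at $0$, that is, there are open neighbourhoods $U,V$ of $0$ in $\mathbb R^n$, a bijection $\varphi\colon U\to V$ with $\varphi(0)=0$ and a constant $c>0$ with $\frac1c\|x-y\|\le\|\varphi(x)-\varphi(y)\|\le c\|x-y\|$ for all $x,y\in U$, and constants $c_1,c_2>0$ such that $c_2|f(x)|\le|g(\varphi(x))|\le c_1|f(x)|$ for all $x$ in some neighbourhood of $0$. Then $\mu(f)=\mu(g)$. -/

import Mathlib

open Filter Topology Asymptotics
open scoped ContDiff

/-- `ℝⁿ` with its Euclidean norm. -/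
abbrev RSpace (n : ℕ) : Type := EuclideanSpace ℝ (Fin n)

/-- `f` represents the germ at `0` of a `C^∞` function: it is `C^∞` on a whole neighbourhood of `0`.
(This is stronger than `ContDiffAt ℝ ∞ f 0`, which lets the neighbourhood shrink with the order
of differentiability.) -/
def IsSmoothGerm {n : ℕ} (f : RSpace n → ℝ) : Prop :=
  ∀ᶠ x in 𝓝 (0 : RSpace n), ContDiffAt ℝ ∞ f x

/-- The partial derivative `∂f/∂xᵢ`. -/
noncomputable def partialD {n : ℕ} (i : Fin n) (f : RSpace n → ℝ) : RSpace n → ℝ :=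
  fun x => fderiv ℝ f x (EuclideanSpace.single i (1 : ℝ))

theorem IsSmoothGerm.partialD {n : ℕ} {f : RSpace n → ℝ} (hf : IsSmoothGerm f) (i : Fin n) :
    IsSmoothGerm (partialD i f) := by
  filter_upwards [hf] with x hx
  have h : ContDiffAt ℝ ∞ (fderiv ℝ f) x := hx.fderiv_right (by simp)
  exact h.clm_apply contDiffAt_const

/-- The pointwise `ℝ`-algebra structure on germs at `0` of arbitrary functions `ℝⁿ → ℝ`. -/
noncomputable instance germAlgebra (n : ℕ) : Algebra ℝ (Germ (𝓝 (0 : RSpace n)) ℝ) :=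
  Algebra.ofModule
    (fun r x y => by
      induction x using Germ.inductionOn with | _ f
      induction y using Germ.inductionOn with | _ g
      exact congrArg Germ.ofFun (smul_mul_assoc r f g))
    (fun r x y => by
      induction x using Germ.inductionOn with | _ f
      induction y using Germ.inductionOn with | _ g
      exact congrArg Germ.ofFun (mul_smul_comm r f g))

/-- The `ℝ`-algebra `𝓔ₙ` of germs at `0` of `C^∞` functions `ℝⁿ → ℝ`. -/
noncomputable def smoothGerms (n : ℕ) : Subalgebra ℝ (Germ (𝓝 (0 : RSpace n)) ℝ) where
  carrier := {p | ∃ f : RSpace n → ℝ, IsSmoothGerm f ∧ p = (f : Germ (𝓝 (0 : RSpace n)) ℝ)}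
  mul_mem' := by
    rintro _ _ ⟨f, hf, rfl⟩ ⟨g, hg, rfl⟩
    refine ⟨f * g, ?_, rfl⟩
    filter_upwards [hf, hg] with x h₁ h₂
    exact h₁.mul h₂
  add_mem' := by
    rintro _ _ ⟨f, hf, rfl⟩ ⟨g, hg, rfl⟩
    refine ⟨f + g, ?_, rfl⟩
    filter_upwards [hf, hg] with x h₁ h₂
    exact h₁.add h₂
  algebraMap_mem' := by
    intro r
    refine ⟨fun _ => r, Eventually.of_forall fun _ => contDiffAt_const, ?_⟩
    rw [Algebra.algebraMap_eq_smul_one]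
    refine congrArg Germ.ofFun (funext fun x => ?_)
    simp

/-- The element of `𝓔ₙ` represented by `f`. -/
noncomputable def IsSmoothGerm.germ {n : ℕ} {f : RSpace n → ℝ} (hf : IsSmoothGerm f) :
    smoothGerms n :=
  ⟨(f : Germ (𝓝 (0 : RSpace n)) ℝ), f, hf, rfl⟩

/-- The Jacobian ideal `J(f) ⊆ 𝓔ₙ`, generated by the partial derivatives of `f`. -/
noncomputable def jacobianIdeal {n : ℕ} (f : RSpace n → ℝ) (hf : IsSmoothGerm f) :
    Ideal (smoothGerms n) :=
  Ideal.span (Set.range fun i : Fin n => (hf.partialD i).germ)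

/-- The real Milnor number `μ(f) = dim_ℝ 𝓔ₙ / J(f)`, with value `⊤` if the dimension is infinite. -/
noncomputable def milnorNumber {n : ℕ} (f : RSpace n → ℝ) (hf : IsSmoothGerm f) : ℕ∞ :=
  Cardinal.toENat (Module.rank ℝ (smoothGerms n ⧸ jacobianIdeal f hf))

/-- `f ∈ 𝓔ₙ` has an algebraically isolated singularity at `0`: its Milnor number is finite. -/
def AlgIsolatedSing {n : ℕ} (f : RSpace n → ℝ) : Prop :=
  ∃ hf : IsSmoothGerm f, milnorNumber f hf < ⊤

/-- `h` is the initial part `in(f)` of `f` at `0`: for some `α ≥ 0`, `h` is (positively) homogeneous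
of degree `α`, `h(x) / ‖x‖^α` does not tend to `0`, and `f(x) - h(x) = o(‖x‖^α)` as `x → 0`.
For a smooth `f` there is at most one such `h`, namely the nonzero homogeneous part of lowest degree
of its Taylor series. -/
def IsInitialPart {n : ℕ} (f h : RSpace n → ℝ) : Prop :=
  ∃ α : ℝ, 0 ≤ α ∧
    (∀ t : ℝ, 0 < t → ∀ x, h (t • x) = t ^ α * h x) ∧
    ¬ (h =o[𝓝 0] fun x => ‖x‖ ^ α) ∧
    (fun x => f x - h x) =o[𝓝 0] fun x => ‖x‖ ^ α

/-- `φ` restricts to a lipeomorphism (bi-Lipschitz bijection) from `U` onto `V`. -/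
def IsLipeomorphism {n : ℕ} (φ : RSpace n → RSpace n) (U V : Set (RSpace n)) : Prop :=
  Set.BijOn φ U V ∧ ∃ c : ℝ, 0 < c ∧ ∀ x ∈ U, ∀ y ∈ U,
    1 / c * ‖x - y‖ ≤ ‖φ x - φ y‖ ∧ ‖φ x - φ y‖ ≤ c * ‖x - y‖

/-- `F ∼₀ G`: asymptotic equivalence at `0`. -/
def AsympEquivAtZero {n : ℕ} (F G : RSpace n → ℝ) : Prop :=
  ∃ c₁ c₂ : ℝ, 0 < c₁ ∧ 0 < c₂ ∧
    ∀ᶠ x in 𝓝 (0 : RSpace n), c₂ * ‖F x‖ ≤ ‖G x‖ ∧ ‖G x‖ ≤ c₁ * ‖F x‖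

/-- `f` and `g` are `𝓡`-asymptotically Lipschitz equivalent at `0`: `f ∼₀ g ∘ φ` for a germ of
lipeomorphism `φ : (ℝⁿ, 0) → (ℝⁿ, 0)`. -/
def RAsympLipEquiv {n : ℕ} (f g : RSpace n → ℝ) : Prop :=
  ∃ (φ : RSpace n → RSpace n) (U V : Set (RSpace n)),
    IsOpen U ∧ IsOpen V ∧ (0 : RSpace n) ∈ U ∧ φ 0 = 0 ∧ IsLipeomorphism φ U V ∧
      AsympEquivAtZero f (g ∘ φ)

/-
In suitable linear coordinates the partial derivatives of a form `Q` of degree `d + 1` with an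
isolated singularity are a regular sequence of `n` forms of degree `d`. Adding terms of higher order
to them changes neither their leading forms nor the number of standard monomials, so
`μ(f) = μ(Q) = d ^ n` whenever `Q` is the initial form of `f`. Since `f` is not `o(‖x‖ ^ (d + 1))`,
the relations `f = O(g ∘ φ)` and `φ(x) = O(x)` show that the initial form of `g` has degree at most
`d + 1`, and the inverse of `φ` gives the opposite inequality.
-/

section Quotients

variable {A : Type*} [CommRing A]

theorem span_image_Iio_succ (q : ℕ → A) (j : ℕ) :
    Ideal.span (q '' Set.Iio (j + 1)) = Ideal.span (q '' Set.Iio j) ⊔ Ideal.span {q j} := by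
  rw [Set.Iio_add_one_eq_Iic, ← Set.Iio_insert, Set.image_insert_eq, Set.insert_eq, sup_comm,
    Ideal.span_union]

theorem mul_mem_pow_of_le {I : Ideal A} {a b : A} {i j k : ℕ} (ha : a ∈ I ^ i) (hb : b ∈ I ^ j)
    (hk : k ≤ i + j) : a * b ∈ I ^ k :=
  Ideal.pow_le_pow_right hk (pow_add I i j ▸ Ideal.mul_mem_mul ha hb)

theorem mem_sup_pow_of_le {I J : Ideal A} {a : A} {s t : ℕ} (ha : a ∈ I ⊔ J ^ s) (h : t ≤ s) :
    a ∈ I ⊔ J ^ t :=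
  sup_le_sup_left (Ideal.pow_le_pow_right h) I ha

theorem colon_singleton_eq_self_of_isSMulRegular {I : Ideal A} {g : A}
    (hg : IsSMulRegular (A ⧸ I) g) : I.colon {g} = I := by
  refine le_antisymm (fun u hu => ?_) fun u hu => ?_
  · refine mem_of_isSMulRegular_quotient_of_smul_mem hg ?_
    rw [smul_eq_mul, mul_comm]
    exact Submodule.mem_colon_singleton.mp hu
  · exact Submodule.mem_colon_singleton.mpr (I.mul_mem_right g hu)

/-- Multiplication by `g`, as a map `A ⧸ (I : g) → A ⧸ I`. -/
def mulQuotient (I : Ideal A) (g : A) : (A ⧸ I.colon {g}) →ₗ[A] (A ⧸ I) :=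
  Submodule.mapQ (I.colon {g}) I (LinearMap.mulRight A g) fun _ => Submodule.mem_colon_singleton.mp

theorem mulQuotient_injective (I : Ideal A) (g : A) : Function.Injective (mulQuotient I g) := by
  rw [injective_iff_map_eq_zero]
  intro x hx
  obtain ⟨u, rfl⟩ := Ideal.Quotient.mk_surjective x
  have hu : u * g ∈ I := Ideal.Quotient.eq_zero_iff_mem.mp hx
  exact Ideal.Quotient.eq_zero_iff_mem.mpr (Submodule.mem_colon_singleton.mpr hu)

theorem exact_mulQuotient_factor (I : Ideal A) (g : A) :
    Function.Exact (mulQuotient I g)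
      (Submodule.factor (le_sup_left : I ≤ I ⊔ Ideal.span {g})) := by
  intro x
  obtain ⟨u, rfl⟩ := Ideal.Quotient.mk_surjective x
  constructor
  · intro hx
    have hu : u ∈ I ⊔ Ideal.span {g} := Ideal.Quotient.eq_zero_iff_mem.mp hx
    rw [sup_comm, Ideal.mem_span_singleton_sup] at hu
    obtain ⟨a, v, hv, rfl⟩ := hu
    refine ⟨Ideal.Quotient.mk _ a, Ideal.Quotient.eq.mpr (?_ : a * g - (a * g + v) ∈ I)⟩
    simpa using hv
  · rintro ⟨y, hy⟩
    obtain ⟨a, rfl⟩ := Ideal.Quotient.mk_surjective y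
    rw [← hy]
    exact Ideal.Quotient.eq_zero_iff_mem.mpr (Ideal.mem_sup_right
      (Ideal.mul_mem_left _ a (Ideal.mem_span_singleton_self g)))

theorem finrank_quotient_eq_add {K : Type*} [Field K] [Algebra K A] (I : Ideal A) (g : A)
    [Module.Finite K (A ⧸ I)] :
    Module.finrank K (A ⧸ I) =
      Module.finrank K (A ⧸ I ⊔ Ideal.span {g}) + Module.finrank K (A ⧸ I.colon {g}) := by
  let ι : (A ⧸ I.colon {g}) →ₗ[K] (A ⧸ I) := (mulQuotient I g).restrictScalars K
  let π : (A ⧸ I) →ₗ[K] (A ⧸ I ⊔ Ideal.span {g}) :=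
    (Ideal.Quotient.factorₐ K le_sup_left).toLinearMap
  have hι : Function.Injective ι := mulQuotient_injective I g
  have hπ : Function.Surjective π := Ideal.Quotient.factor_surjective le_sup_left
  have hexact : Function.Exact ι π := exact_mulQuotient_factor I g
  have h := LinearMap.finrank_range_add_finrank_ker π
  rw [hexact.linearMap_ker_eq, LinearMap.range_eq_top.mpr hπ, finrank_top,
    LinearMap.finrank_range_of_inj hι] at h
  exact h.symm

end Quotients

section RegularSequences

/-- `q 0, …, q (j - 1)` is a weakly regular sequence on `A`. Sequences are indexed by `ℕ` to keep
the initial segments easy to handle. -/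
def IsRegularSeq {A : Type*} [CommRing A] (q : ℕ → A) (j : ℕ) : Prop :=
  ∀ i < j, IsSMulRegular (A ⧸ Ideal.span (q '' Set.Iio i)) (q i)

theorem IsRegularSeq.mono {A : Type*} [CommRing A] {q : ℕ → A} {i j : ℕ} (hq : IsRegularSeq q j)
    (hij : i ≤ j) : IsRegularSeq q i :=
  fun k hk => hq k (hk.trans_le hij)

theorem isRegularSeq_congr {A : Type*} [CommRing A] {q q' : ℕ → A} {j : ℕ}
    (h : ∀ i < j, q i = q' i) : IsRegularSeq q j ↔ IsRegularSeq q' j := by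
  refine forall₂_congr fun i hi => ?_
  rw [h i hi, Set.image_congr (s := Set.Iio i) fun k hk => h k (lt_trans hk hi)]

open CategoryTheory Abelian

universe u

variable {R : Type u} [CommRing R]

theorem subsingleton_ext_quotient_sup_span {N : ModuleCat.{u} R} {I : Ideal R} {q : R}
    (hq : IsSMulRegular (R ⧸ I) q) {r : ℕ}
    (h : ∀ i < r + 1, Subsingleton (Ext N (ModuleCat.of R (R ⧸ I)) i)) :
    ∀ i < r, Subsingleton (Ext N (ModuleCat.of R (R ⧸ I ⊔ Ideal.span {q})) i) := by
  intro i hi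
  have hS := ModuleCat.shortComplex_shortExact
    (ModuleCat.shortComplexOfCompEqZero _ _ (exact_mulQuotient_factor I q).linearMap_comp_eq_zero)
    (exact_mulQuotient_factor I q) (mulQuotient_injective I q)
    (Submodule.factor_surjective le_sup_left)
  have h₃ : Subsingleton (Ext N (ModuleCat.of R (R ⧸ I.colon {q})) (i + 1)) := by
    rw [colon_singleton_eq_self_of_isSMulRegular hq]
    exact h (i + 1) (by omega)
  have zero₁ := AddCommGrpCat.isZero_of_iff_subsingleton.mpr (h i (by omega))
  have zero₂ := AddCommGrpCat.isZero_of_iff_subsingleton.mpr h₃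
  exact AddCommGrpCat.subsingleton_of_isZero <| ShortComplex.Exact.isZero_of_both_zeros
    ((Ext.covariant_sequence_exact₃' N hS) i (i + 1) rfl)
    (zero₁.eq_zero_of_src _) (zero₂.eq_zero_of_tgt _)

theorem subsingleton_ext_quotient_of_isRegularSeq {N : ModuleCat.{u} R} {n j : ℕ} (hj : j ≤ n)
    (hN : ∀ i < n, Subsingleton (Ext N (ModuleCat.of R R) i)) {q : ℕ → R}
    (hq : IsRegularSeq q j) :
    ∀ i < n - j, Subsingleton (Ext N (ModuleCat.of R (R ⧸ Ideal.span (q '' Set.Iio j))) i) := by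
  induction j with
  | zero =>
    intro i hi
    have e : (R ⧸ Ideal.span (q '' Set.Iio 0)) ≃ₗ[R] R := Submodule.quotEquivOfEqBot _ (by simp)
    have : Subsingleton ((extFunctorObj N i).obj (ModuleCat.of R R)) := hN i hi
    exact ((extFunctorObj N i).mapIso e.toModuleIso).addCommGroupIsoToAddEquiv.subsingleton
  | succ j ih =>
    rw [span_image_Iio_succ]
    refine subsingleton_ext_quotient_sup_span (hq j j.lt_succ_self) fun i hi => ?_
    exact ih (by omega) (hq.mono j.le_succ) i (by omega)

theorem subsingleton_linearMap_of_subsingleton_ext {M N : Type u} [AddCommGroup M] [Module R M]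
    [AddCommGroup N] [Module R N]
    [Subsingleton (Ext (ModuleCat.of R N) (ModuleCat.of R M) 0)] : Subsingleton (N →ₗ[R] M) :=
  have : Subsingleton (ModuleCat.of R N ⟶ ModuleCat.of R M) :=
    Ext.addEquiv₀.symm.subsingleton
  (ModuleCat.homAddEquiv (M := ModuleCat.of R N) (N := ModuleCat.of R M)).symm.subsingleton

/-- This is the independence of the depth of `𝔞` on `R` of the chosen regular sequence. -/
theorem mem_span_of_forall_mul_mem {n j : ℕ} (hj : j < n) {𝔞 : Ideal R}
    (hN : ∀ i < n, Subsingleton (Ext (ModuleCat.of R (R ⧸ 𝔞)) (ModuleCat.of R R) i))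
    {q : ℕ → R} (hq : IsRegularSeq q j) {u : R}
    (hu : ∀ a ∈ 𝔞, a * u ∈ Ideal.span (q '' Set.Iio j)) : u ∈ Ideal.span (q '' Set.Iio j) := by
  have := subsingleton_ext_quotient_of_isRegularSeq hj.le hN hq 0 (by omega)
  have hlin : Subsingleton ((R ⧸ 𝔞) →ₗ[R] (R ⧸ Ideal.span (q '' Set.Iio j))) :=
    subsingleton_linearMap_of_subsingleton_ext
  let mulRight : (R ⧸ 𝔞) →ₗ[R] (R ⧸ Ideal.span (q '' Set.Iio j)) :=
    Submodule.liftQ 𝔞 ((Submodule.mkQ _).comp (LinearMap.mulRight R u)) fun a ha =>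
      Ideal.Quotient.eq_zero_iff_mem.mpr (hu a ha)
  have h₁ : Ideal.Quotient.mk (Ideal.span (q '' Set.Iio j)) (1 * u) = 0 :=
    LinearMap.congr_fun (Subsingleton.elim mulRight 0) (Ideal.Quotient.mk 𝔞 1)
  rwa [one_mul, Ideal.Quotient.eq_zero_iff_mem] at h₁

end RegularSequences

section LowDegree

open MvPolynomial

variable {σ R : Type*} [CommRing R]

theorem mem_pow_idealOfVars_of_isHomogeneous {d : ℕ} {u : MvPolynomial σ R}
    (hu : u.IsHomogeneous d) : u ∈ idealOfVars σ R ^ d := by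
  rw [mem_pow_idealOfVars_iff']
  exact fun x hx => hu.coeff_eq_zero (ne_of_lt hx)

/-- The part of degree less than `d` of a polynomial, that is, its truncation modulo
`(x₁, …, xₙ) ^ d`. -/
noncomputable def lowDegreePart (d : ℕ) : MvPolynomial σ R →ₗ[R] MvPolynomial σ R :=
  ∑ i ∈ Finset.range d, homogeneousComponent i

theorem coeff_lowDegreePart (d : ℕ) (u : MvPolynomial σ R) (x : σ →₀ ℕ) :
    coeff x (lowDegreePart d u) = if x.degree < d then coeff x u else 0 := by
  classical
  simp [lowDegreePart, coeff_sum, coeff_homogeneousComponent]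

theorem lowDegreePart_eq_zero_iff {d : ℕ} {u : MvPolynomial σ R} :
    lowDegreePart d u = 0 ↔ u ∈ idealOfVars σ R ^ d := by
  simp [mem_pow_idealOfVars_iff', MvPolynomial.ext_iff, coeff_lowDegreePart]

theorem sub_lowDegreePart_mem (d : ℕ) (u : MvPolynomial σ R) :
    u - lowDegreePart d u ∈ idealOfVars σ R ^ d := by
  rw [mem_pow_idealOfVars_iff']
  intro x hx
  simp [coeff_lowDegreePart, hx]

theorem lowDegreePart_eq_self {d : ℕ} {u : MvPolynomial σ R}
    (hu : ∀ x ∈ u.support, x.degree < d) : lowDegreePart d u = u := by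
  ext x
  rw [coeff_lowDegreePart, ite_eq_left_iff]
  intro hx
  by_contra hne
  exact hx (hu x (mem_support_iff.mpr (Ne.symm hne)))

theorem lowDegreePart_mul {d m : ℕ} (a : MvPolynomial σ R) {p : MvPolynomial σ R}
    (hp : p.IsHomogeneous m) : lowDegreePart (d + m) (a * p) = lowDegreePart d a * p := by
  have hhigh : lowDegreePart (d + m) ((a - lowDegreePart d a) * p) = 0 := by
    rw [lowDegreePart_eq_zero_iff, pow_add]
    exact Ideal.mul_mem_mul (sub_lowDegreePart_mem d a) (mem_pow_idealOfVars_of_isHomogeneous hp)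
  have hlow : lowDegreePart (d + m) (lowDegreePart d a * p) = lowDegreePart d a * p := by
    classical
    refine lowDegreePart_eq_self fun x hx => ?_
    obtain ⟨y, hy, z, hz, rfl⟩ := Finset.mem_add.mp (support_mul _ _ hx)
    rw [map_add]
    have hyd : y.degree < d := by
      by_contra h
      simp [coeff_lowDegreePart, h] at hy
    have hzm : z.degree = m := by
      by_contra h
      exact mem_support_iff.mp hz (hp.coeff_eq_zero h)
    omega
  rw [← hlow, ← sub_eq_zero, ← map_sub, ← sub_mul, hhigh]

theorem lowDegreePart_mem_span {d m : ℕ} {S : Set (MvPolynomial σ R)}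
    (hS : ∀ p ∈ S, p.IsHomogeneous m) {v : MvPolynomial σ R} (hv : v ∈ Ideal.span S) :
    lowDegreePart (d + m) v ∈ Ideal.span S := by
  induction hv using Submodule.closure_induction with
  | zero => simp
  | add x y _ _ hx hy => simpa using add_mem hx hy
  | smul_mem a p hp =>
    rw [smul_eq_mul, lowDegreePart_mul a (hS p hp)]
    exact Ideal.mul_mem_left _ _ (Ideal.subset_span hp)

theorem sub_lowDegreePart_mem_mul_span {d m : ℕ} {S : Set (MvPolynomial σ R)}
    (hS : ∀ p ∈ S, p.IsHomogeneous m) {v : MvPolynomial σ R} (hv : v ∈ Ideal.span S) :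
    v - lowDegreePart (d + m) v ∈ idealOfVars σ R ^ d * Ideal.span S := by
  induction hv using Submodule.closure_induction with
  | zero => simp
  | add x y _ _ hx hy =>
    rw [map_add, add_sub_add_comm]
    exact add_mem hx hy
  | smul_mem a p hp =>
    rw [smul_eq_mul, lowDegreePart_mul a (hS p hp), ← sub_mul]
    exact Ideal.mul_mem_mul (sub_lowDegreePart_mem d a) (Ideal.subset_span hp)

theorem span_inf_pow_le_mul_span {m : ℕ} (s : ℕ) {S : Set (MvPolynomial σ R)}
    (hS : ∀ p ∈ S, p.IsHomogeneous m) :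
    Ideal.span S ⊓ idealOfVars σ R ^ s ≤ idealOfVars σ R ^ (s - m) * Ideal.span S := by
  rintro v ⟨hv, hvs⟩
  rcases le_total s m with h | h
  · simpa [Nat.sub_eq_zero_of_le h] using hv
  · have := sub_lowDegreePart_mem_mul_span (d := s - m) hS hv
    rwa [Nat.sub_add_cancel h, lowDegreePart_eq_zero_iff.mpr hvs, sub_zero] at this

theorem mem_span_sup_pow_of_mul_mem {m s : ℕ} {S : Set (MvPolynomial σ R)}
    (hS : ∀ p ∈ S, p.IsHomogeneous m) {p : MvPolynomial σ R} (hp : p.IsHomogeneous m)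
    (hreg : IsSMulRegular (MvPolynomial σ R ⧸ Ideal.span S) p) {u : MvPolynomial σ R}
    (hu : u * p ∈ Ideal.span S ⊔ idealOfVars σ R ^ (s + m)) :
    u ∈ Ideal.span S ⊔ idealOfVars σ R ^ s := by
  obtain ⟨v, hv, w, hw, hvw⟩ := Submodule.mem_sup.mp hu
  have h := congrArg (lowDegreePart (s + m)) hvw
  rw [map_add, lowDegreePart_eq_zero_iff.mpr hw, add_zero, lowDegreePart_mul u hp, mul_comm] at h
  have hlow : lowDegreePart s u ∈ Ideal.span S :=
    mem_of_isSMulRegular_quotient_of_smul_mem hreg (h.subst (lowDegreePart_mem_span hS hv))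
  exact Submodule.mem_sup.mpr ⟨_, hlow, _, sub_lowDegreePart_mem s u, by ring⟩

theorem mem_span_of_mem_sup_pow {m d : ℕ} {S : Set (MvPolynomial σ R)}
    (hS : ∀ p ∈ S, p.IsHomogeneous m) {u : MvPolynomial σ R} (hu : u.IsHomogeneous d)
    (h : u ∈ Ideal.span S ⊔ idealOfVars σ R ^ (d + 1 + m)) : u ∈ Ideal.span S := by
  obtain ⟨v, hv, w, hw, hvw⟩ := Submodule.mem_sup.mp h
  have hlow : lowDegreePart (d + 1 + m) u = u := by
    refine lowDegreePart_eq_self fun x hx => ?_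
    by_contra h
    exact mem_support_iff.mp hx (hu.coeff_eq_zero (by omega))
  rw [← hlow, ← hvw, map_add, lowDegreePart_eq_zero_iff.mpr hw, add_zero]
  exact lowDegreePart_mem_span hS hv

theorem range_lowDegreePart (d : ℕ) :
    LinearMap.range (lowDegreePart d) = restrictSupport R {x : σ →₀ ℕ | x.degree < d} := by
  ext u
  rw [LinearMap.mem_range, mem_restrictSupport_iff]
  constructor
  · rintro ⟨v, rfl⟩ x hx
    by_contra h
    exact mem_support_iff.mp hx ((coeff_lowDegreePart d v x).trans (if_neg h))
  · exact fun hu => ⟨u, lowDegreePart_eq_self fun x hx => hu hx⟩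

/-- The residue classes modulo `(x₁, …, xₙ) ^ N` are the polynomials of degree less than `N`. -/
noncomputable def quotientPowIdealOfVarsEquiv (N : ℕ) :
    (MvPolynomial σ R ⧸ idealOfVars σ R ^ N) ≃ₗ[R]
      restrictSupport R {x : σ →₀ ℕ | x.degree < N} :=
  have hker : (idealOfVars σ R ^ N).restrictScalars R = LinearMap.ker (lowDegreePart N) :=
    Submodule.ext fun _ => lowDegreePart_eq_zero_iff.symm
  (Submodule.Quotient.restrictScalarsEquiv R _).symm ≪≫ₗ Submodule.quotEquivOfEq _ _ hker ≪≫ₗ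
    (lowDegreePart N).quotKerEquivRange ≪≫ₗ LinearEquiv.ofEq _ _ (range_lowDegreePart N)

instance finite_quotient_pow_idealOfVars [Finite σ] (N : ℕ) :
    Module.Finite R (MvPolynomial σ R ⧸ idealOfVars σ R ^ N) := by
  have : Finite {x : σ →₀ ℕ | x.degree < N} := Finsupp.finite_of_degree_lt N
  exact .of_basis ((basisRestrictSupport R _).map (quotientPowIdealOfVarsEquiv N).symm)

theorem finrank_quotient_pow_idealOfVars [Nontrivial R] (N : ℕ) :
    Module.finrank R (MvPolynomial σ R ⧸ idealOfVars σ R ^ N) =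
      {x : σ →₀ ℕ | x.degree < N}.ncard := by
  rw [(quotientPowIdealOfVarsEquiv N).finrank_eq,
    Module.finrank_eq_nat_card_basis (basisRestrictSupport R _), Nat.card_coe_set_eq]

end LowDegree

section Deformation

open MvPolynomial

variable {σ R : Type*} [CommRing R] {m : ℕ}

local notation "𝔪" => idealOfVars σ R

/-- `G` has order at least `m`, and `p` is its homogeneous part of degree `m`. -/
structure HasLeadingForm (m : ℕ) (G p : MvPolynomial σ R) : Prop where
  isHomogeneous : p.IsHomogeneous m
  sub_mem : G - p ∈ 𝔪 ^ (m + 1)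

/-- The form of lowest degree of every element of `I` belongs to `P`. -/
def InitialFormsLE (I P : Ideal (MvPolynomial σ R)) : Prop :=
  ∀ s, ∀ u ∈ 𝔪 ^ s, u ∈ I ⊔ 𝔪 ^ (s + 1) → u ∈ P ⊔ 𝔪 ^ (s + 1)

theorem HasLeadingForm.mem_pow {G p : MvPolynomial σ R} (h : HasLeadingForm m G p) :
    G ∈ 𝔪 ^ m := by
  rw [← sub_add_cancel G p]
  exact add_mem (Ideal.pow_le_pow_right m.le_succ h.sub_mem)
    (mem_pow_idealOfVars_of_isHomogeneous h.isHomogeneous)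

theorem HasLeadingForm.mul_sub_mem {G p u : MvPolynomial σ R} {s t : ℕ}
    (h : HasLeadingForm m G p) (hu : u ∈ 𝔪 ^ s) (ht : t ≤ s + m + 1) : u * (G - p) ∈ 𝔪 ^ t :=
  mul_mem_pow_of_le hu h.sub_mem (by omega)

theorem HasLeadingForm.linearCombination {ι : Type*} [Fintype ι] {G p : ι → MvPolynomial σ R}
    (h : ∀ i, HasLeadingForm m (G i) (p i)) (c : ι → R) :
    HasLeadingForm m (Fintype.linearCombination R G c) (Fintype.linearCombination R p c) where
  isHomogeneous := by
    rw [Fintype.linearCombination_apply, ← mem_homogeneousSubmodule]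
    exact Submodule.sum_mem _ fun i _ => Submodule.smul_mem _ _ (h i).isHomogeneous
  sub_mem := by
    simp only [Fintype.linearCombination_apply, ← Finset.sum_sub_distrib, ← smul_sub]
    exact Submodule.sum_mem _ fun i _ => Submodule.smul_of_tower_mem _ _ (h i).sub_mem

variable {G p : ℕ → MvPolynomial σ R} {j : ℕ}

theorem isHomogeneous_of_mem_image (h : ∀ i, HasLeadingForm m (G i) (p i)) (s : Set ℕ) :
    ∀ q ∈ p '' s, q.IsHomogeneous m :=
  Set.forall_mem_image.mpr fun i _ => (h i).isHomogeneous

theorem span_le_span_sup_pow (h : ∀ i, HasLeadingForm m (G i) (p i)) (s : Set ℕ) :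
    Ideal.span (p '' s) ≤ Ideal.span (G '' s) ⊔ 𝔪 ^ (m + 1) := by
  rw [Ideal.span_le]
  rintro _ ⟨i, hi, rfl⟩
  exact Submodule.mem_sup.mpr ⟨G i, Ideal.subset_span ⟨i, hi, rfl⟩, -(G i - p i),
    neg_mem (h i).sub_mem, by ring⟩

theorem initialFormsLE_span (h : ∀ i, HasLeadingForm m (G i) (p i)) (s : Set ℕ) :
    InitialFormsLE (Ideal.span (p '' s)) (Ideal.span (G '' s)) := by
  intro d u hu hu'
  obtain ⟨v, hv, w, hw, rfl⟩ := Submodule.mem_sup.mp hu'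
  refine add_mem ?_ (Ideal.mem_sup_right hw)
  have hvd : v ∈ 𝔪 ^ d := by
    simpa using sub_mem hu (Ideal.pow_le_pow_right d.le_succ hw)
  have hle : 𝔪 ^ (d - m) * Ideal.span (p '' s) ≤ Ideal.span (G '' s) ⊔ 𝔪 ^ (d + 1) :=
    calc 𝔪 ^ (d - m) * Ideal.span (p '' s)
        ≤ 𝔪 ^ (d - m) * (Ideal.span (G '' s) ⊔ 𝔪 ^ (m + 1)) :=
          Ideal.mul_mono_right (span_le_span_sup_pow h s)
      _ = 𝔪 ^ (d - m) * Ideal.span (G '' s) ⊔ 𝔪 ^ (d - m + (m + 1)) := by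
          rw [Ideal.mul_sup, ← pow_add]
      _ ≤ Ideal.span (G '' s) ⊔ 𝔪 ^ (d + 1) :=
          sup_le_sup Ideal.mul_le_right (Ideal.pow_le_pow_right (by omega))
  exact hle (span_inf_pow_le_mul_span d (isHomogeneous_of_mem_image h s) ⟨hv, hvd⟩)

theorem mem_span_sup_pow_succ_of_mul_mem (h : ∀ i, HasLeadingForm m (G i) (p i))
    (hreg : IsSMulRegular (MvPolynomial σ R ⧸ Ideal.span (p '' Set.Iio j)) (p j))
    (hin : InitialFormsLE (Ideal.span (G '' Set.Iio j)) (Ideal.span (p '' Set.Iio j)))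
    {s : ℕ} {w : MvPolynomial σ R} (hw : w ∈ 𝔪 ^ s)
    (hwG : w * G j ∈ Ideal.span (G '' Set.Iio j) ⊔ 𝔪 ^ (s + m + 1)) :
    w ∈ Ideal.span (G '' Set.Iio j) ⊔ 𝔪 ^ (s + 1) := by
  have hwGp : w * G j ∈ Ideal.span (p '' Set.Iio j) ⊔ 𝔪 ^ (s + m + 1) :=
    hin (s + m) _ (mul_mem_pow_of_le hw (h j).mem_pow le_rfl) hwG
  have hwp : w * p j ∈ Ideal.span (p '' Set.Iio j) ⊔ 𝔪 ^ (s + m + 1) := by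
    have := sub_mem hwGp (Ideal.mem_sup_right ((h j).mul_sub_mem hw le_rfl))
    rwa [← mul_sub, sub_sub_cancel] at this
  have hwP : w ∈ Ideal.span (p '' Set.Iio j) ⊔ 𝔪 ^ (s + 1) :=
    mem_span_sup_pow_of_mul_mem (isHomogeneous_of_mem_image h _) (h j).isHomogeneous hreg
      (by rwa [add_right_comm])
  exact initialFormsLE_span h _ s w hw hwP

theorem mem_span_sup_pow_of_mul_mem_of_initialFormsLE (h : ∀ i, HasLeadingForm m (G i) (p i))
    (hreg : IsSMulRegular (MvPolynomial σ R ⧸ Ideal.span (p '' Set.Iio j)) (p j))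
    (hin : InitialFormsLE (Ideal.span (G '' Set.Iio j)) (Ideal.span (p '' Set.Iio j)))
    {N : ℕ} {u : MvPolynomial σ R} (hu : u * G j ∈ Ideal.span (G '' Set.Iio j) ⊔ 𝔪 ^ N) :
    u ∈ Ideal.span (G '' Set.Iio j) ⊔ 𝔪 ^ (N - m) := by
  suffices H : ∀ s ≤ N - m, u ∈ Ideal.span (G '' Set.Iio j) ⊔ 𝔪 ^ s from H _ le_rfl
  intro s
  induction s with
  | zero => simp
  | succ s ih =>
    intro hs
    obtain ⟨v, hv, w, hw, rfl⟩ := Submodule.mem_sup.mp (ih (by omega))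
    refine add_mem (Ideal.mem_sup_left hv) (mem_span_sup_pow_succ_of_mul_mem h hreg hin hw ?_)
    have hwG : w * G j ∈ Ideal.span (G '' Set.Iio j) ⊔ 𝔪 ^ N := by
      have := sub_mem hu (Ideal.mem_sup_left (T := 𝔪 ^ N) (Ideal.mul_mem_right (G j) _ hv))
      rwa [add_mul, add_sub_cancel_left] at this
    exact mem_sup_pow_of_le hwG (by omega)

theorem initialFormsLE_span_of_isRegularSeq (h : ∀ i, HasLeadingForm m (G i) (p i))
    (hreg : IsRegularSeq p j) :
    InitialFormsLE (Ideal.span (G '' Set.Iio j)) (Ideal.span (p '' Set.Iio j)) := by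
  induction j with
  | zero => simp [InitialFormsLE]
  | succ j ih =>
    have hin := ih (hreg.mono j.le_succ)
    intro s v hv hv'
    rw [span_image_Iio_succ, sup_right_comm, sup_comm, Ideal.mem_span_singleton_sup] at hv'
    obtain ⟨b, r, hr, rfl⟩ := hv'
    have hbG : b * G j ∈ Ideal.span (G '' Set.Iio j) ⊔ 𝔪 ^ s := by
      have := sub_mem (Ideal.mem_sup_right hv)
        (mem_sup_pow_of_le hr s.le_succ)
      rwa [add_sub_cancel_right] at this
    obtain ⟨e, he, b', hb', rfl⟩ := Submodule.mem_sup.mp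
      (mem_span_sup_pow_of_mul_mem_of_initialFormsLE h (hreg j j.lt_succ_self) hin hbG)
    have hsub : (e + b') * G j + r - b' * p j ∈ Ideal.span (p '' Set.Iio j) ⊔ 𝔪 ^ (s + 1) := by
      refine hin s _ (sub_mem hv (mul_mem_pow_of_le hb'
        (mem_pow_idealOfVars_of_isHomogeneous (h j).isHomogeneous) (by omega))) ?_
      have : (e + b') * G j + r - b' * p j = e * G j + b' * (G j - p j) + r := by ring
      rw [this]
      exact add_mem (add_mem (Ideal.mem_sup_left (Ideal.mul_mem_right _ _ he))
        (Ideal.mem_sup_right ((h j).mul_sub_mem hb' (by omega)))) hr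
    rw [span_image_Iio_succ, sup_right_comm, sup_comm, Ideal.mem_span_singleton_sup]
    exact ⟨b', _, hsub, by ring⟩

theorem colon_span_sup_pow_eq (h : ∀ i, HasLeadingForm m (G i) (p i))
    (hreg : IsRegularSeq p (j + 1)) (N : ℕ) :
    (Ideal.span (G '' Set.Iio j) ⊔ 𝔪 ^ N).colon {G j} =
      Ideal.span (G '' Set.Iio j) ⊔ 𝔪 ^ (N - m) := by
  ext u
  rw [Submodule.mem_colon_singleton, smul_eq_mul]
  constructor
  · exact mem_span_sup_pow_of_mul_mem_of_initialFormsLE h (hreg j j.lt_succ_self)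
      (initialFormsLE_span_of_isRegularSeq h (hreg.mono j.le_succ))
  · intro hu
    obtain ⟨v, hv, w, hw, rfl⟩ := Submodule.mem_sup.mp hu
    rw [add_mul]
    exact add_mem (Ideal.mem_sup_left (Ideal.mul_mem_right _ _ hv))
      (Ideal.mem_sup_right (mul_mem_pow_of_le hw (h j).mem_pow (by omega)))

end Deformation

section Counting

/-- The exponents of the monomials in `n` variables of degree less than `N` that are divisible by
none of `x₀ ^ m, …, xⱼ₋₁ ^ m`. -/
def boundedExponents (n m j N : ℕ) : Set (Fin n →₀ ℕ) :=
  {x | x.degree < N ∧ ∀ i : Fin n, (i : ℕ) < j → x i < m}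

variable {n m j N : ℕ}

theorem finite_boundedExponents : (boundedExponents n m j N).Finite :=
  (Finsupp.finite_of_degree_lt N).subset fun _ hx => hx.1

theorem add_single_mem_boundedExponents_iff (hj : j < n) {y : Fin n →₀ ℕ} :
    y + Finsupp.single ⟨j, hj⟩ m ∈ boundedExponents n m j N ↔
      y ∈ boundedExponents n m j (N - m) := by
  have hcoord (i : Fin n) (hi : (i : ℕ) < j) : Finsupp.single (⟨j, hj⟩ : Fin n) m i = 0 :=
    Finsupp.single_eq_of_ne fun h => hi.ne (congrArg Fin.val h)
  simp +contextual only [boundedExponents, Set.mem_ofPred_eq, map_add, Finsupp.degree_single,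
    Finsupp.add_apply, hcoord, add_zero, Nat.lt_sub_iff_add_lt]

theorem boundedExponents_eq_union (hj : j < n) :
    boundedExponents n m j N = boundedExponents n m (j + 1) N ∪
      (· + Finsupp.single ⟨j, hj⟩ m) '' boundedExponents n m j (N - m) := by
  ext x
  constructor
  · intro hx
    rcases lt_or_ge (x ⟨j, hj⟩) m with hlt | hge
    · refine .inl ⟨hx.1, fun i hi => ?_⟩
      rcases Nat.lt_succ_iff_lt_or_eq.mp hi with h | rfl
      · exact hx.2 i h
      · exact hlt
    · have hle : x - Finsupp.single ⟨j, hj⟩ m + Finsupp.single ⟨j, hj⟩ m = x :=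
        tsub_add_cancel_of_le (Finsupp.single_le_iff.mpr hge)
      exact .inr ⟨_, (add_single_mem_boundedExponents_iff hj).mp (by rwa [hle]), hle⟩
  · rintro (hx | ⟨y, hy, rfl⟩)
    · exact ⟨hx.1, fun i hi => hx.2 i (by omega)⟩
    · exact (add_single_mem_boundedExponents_iff hj).mpr hy

theorem ncard_boundedExponents_eq_add (hj : j < n) :
    (boundedExponents n m j N).ncard =
      (boundedExponents n m (j + 1) N).ncard + (boundedExponents n m j (N - m)).ncard := by
  have hdisj : Disjoint (boundedExponents n m (j + 1) N)
      ((· + Finsupp.single ⟨j, hj⟩ m) '' boundedExponents n m j (N - m)) := by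
    rw [Set.disjoint_right]
    rintro _ ⟨y, -, rfl⟩ ⟨-, h⟩
    simpa using h ⟨j, hj⟩ j.lt_succ_self
  rw [boundedExponents_eq_union hj, Set.ncard_union_eq hdisj finite_boundedExponents
    (finite_boundedExponents.image _), Set.ncard_image_of_injective _ (add_left_injective _)]

theorem ncard_boundedExponents_self (hN : n * m < N) :
    (boundedExponents n m n N).ncard = m ^ n := by
  have hbox : Finsupp.equivFunOnFinite '' boundedExponents n m n N =
      (Fintype.piFinset fun _ : Fin n => Finset.range m : Finset (Fin n → ℕ)) := by
    ext x
    have hdegree (hx : ∀ i, x i < m) : ∑ i, x i < N :=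
      (Finset.sum_le_card_nsmul _ _ m fun i _ => (hx i).le).trans_lt (by simpa using hN)
    suffices (∑ i, x i < N ∧ ∀ i, x i < m) ↔ ∀ i, x i < m by
      simpa [boundedExponents, Equiv.image_eq_preimage_symm, Finsupp.degree_eq_sum] using this
    exact and_iff_right_of_imp hdegree
  rw [← Set.ncard_image_of_injective _ Finsupp.equivFunOnFinite.injective, hbox,
    Set.ncard_coe_finset]
  simp

variable {K : Type*} [Field K] {p G : ℕ → MvPolynomial (Fin n) K}

local notation "𝔪" => MvPolynomial.idealOfVars (Fin n) K

theorem finrank_quotient_span_sup_pow (hG : ∀ i, HasLeadingForm m (G i) (p i)) (hj : j ≤ n)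
    (hreg : IsRegularSeq p j) :
    Module.finrank K (MvPolynomial (Fin n) K ⧸ Ideal.span (G '' Set.Iio j) ⊔ 𝔪 ^ N) =
      (boundedExponents n m j N).ncard := by
  induction j generalizing N with
  | zero =>
    rw [show Ideal.span (G '' Set.Iio 0) ⊔ 𝔪 ^ N = 𝔪 ^ N by simp,
      finrank_quotient_pow_idealOfVars]
    simp [boundedExponents]
  | succ j ih =>
    have : Module.Finite K (MvPolynomial (Fin n) K ⧸ Ideal.span (G '' Set.Iio j) ⊔ 𝔪 ^ N) :=
      Module.Finite.of_surjective (Ideal.Quotient.factorₐ K le_sup_right).toLinearMap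
        (Ideal.Quotient.factor_surjective (le_sup_right (b := 𝔪 ^ N)))
    have hsplit := finrank_quotient_eq_add (K := K) (Ideal.span (G '' Set.Iio j) ⊔ 𝔪 ^ N) (G j)
    rw [colon_span_sup_pow_eq hG hreg, sup_right_comm, ← span_image_Iio_succ,
      ih (Nat.le_of_succ_le hj) (hreg.mono j.le_succ), ih (Nat.le_of_succ_le hj)
      (hreg.mono j.le_succ), ncard_boundedExponents_eq_add hj] at hsplit
    exact (Nat.add_right_cancel hsplit).symm

end Counting

section PrimeAvoidance

variable {K : Type*} [Field K]

theorem linearIndependent_update {V : Type*} [AddCommGroup V] [Module K V] {j : ℕ} {c : ℕ → V}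
    {v : V} (hc : LinearIndependent K fun i : Fin j => c i)
    (hv : v ∉ Submodule.span K (Set.range fun i : Fin j => c i)) :
    LinearIndependent K fun i : Fin (j + 1) => Function.update c j v i := by
  have hsnoc : (fun i : Fin (j + 1) => Function.update c j v i) =
      Fin.snoc (α := fun _ => V) (fun i : Fin j => c i) v := by
    funext i
    refine Fin.lastCases (by simp) (fun l => ?_) i
    rw [Fin.snoc_castSucc, Fin.val_castSucc, Function.update_of_ne l.2.ne]
  rw [hsnoc, linearIndependent_finSnoc]
  exact ⟨hc, hv⟩

theorem span_linearCombination_eq {ι κ A : Type*} [Fintype ι] [CommRing A] [Algebra K A]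
    {s : Set κ} {c : κ → ι → K} (hc : Submodule.span K (c '' s) = ⊤) (G : ι → A) :
    Ideal.span ((fun i => Fintype.linearCombination K G (c i)) '' s) =
      Ideal.span (Set.range G) := by
  classical
  apply le_antisymm
  · rw [Ideal.span_le]
    rintro _ ⟨i, -, rfl⟩
    exact Submodule.sum_mem _ fun l _ =>
      Submodule.smul_of_tower_mem _ _ (Ideal.subset_span ⟨l, rfl⟩)
  · rw [Ideal.span_le]
    rintro _ ⟨l, rfl⟩
    have hle : Submodule.span K (c '' s) ≤ ((Ideal.span
        ((fun i => Fintype.linearCombination K G (c i)) '' s)).restrictScalars K).comap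
          (Fintype.linearCombination K G) := by
      rw [Submodule.span_le]
      rintro _ ⟨i, hi, rfl⟩
      exact Ideal.subset_span ⟨i, hi, rfl⟩
    have hmem : Pi.single l 1 ∈ Submodule.span K (c '' s) := hc ▸ Submodule.mem_top
    simpa using hle hmem

variable [Infinite K]

theorem exists_linearCombination_isSMulRegular {R M ι : Type*} [CommRing R] [IsNoetherianRing R]
    [Algebra K R] [AddCommGroup M] [Module R M] [Module.Finite R M] [Fintype ι] {p : ι → R}
    (hp : ∀ 𝔭 ∈ associatedPrimes R M, ∃ i, p i ∉ 𝔭) {W : Submodule K (ι → K)} (hW : W ≠ ⊤) :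
    ∃ c ∉ W, IsSMulRegular M (Fintype.linearCombination K p c) := by
  classical
  have hfin := associatedPrimes.finite R M
  let V (𝔭 : Ideal R) : Submodule K (ι → K) :=
    (𝔭.restrictScalars K).comap (Fintype.linearCombination K p)
  have hV : ∀ 𝔭 ∈ associatedPrimes R M, V 𝔭 ≠ ⊤ := by
    intro 𝔭 h𝔭 htop
    obtain ⟨i, hi⟩ := hp 𝔭 h𝔭
    have h : Fintype.linearCombination K p (Pi.single i 1) ∈ 𝔭 :=
      (htop ▸ Submodule.mem_top : Pi.single i 1 ∈ V 𝔭)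
    exact hi (by simpa using h)
  have htop : ⊤ ∉ insert W (hfin.toFinset.image V) := by
    rw [Finset.mem_insert, Finset.mem_image]
    rintro (h | ⟨𝔭, h𝔭, h⟩)
    · exact hW h.symm
    · exact hV 𝔭 (hfin.mem_toFinset.mp h𝔭) h
  obtain ⟨c, hc⟩ :=
    (Set.ne_univ_iff_exists_notMem _).mp (Subspace.biUnion_ne_univ_of_top_notMem htop)
  simp only [Set.mem_iUnion, not_exists] at hc
  refine ⟨c, hc W (Finset.mem_insert_self _ _), of_not_not fun hreg => ?_⟩
  obtain ⟨𝔭, h𝔭, hmem⟩ :=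
    Set.mem_iUnion₂.mp ((biUnion_associatedPrimes_eq_compl_regular R M).ge hreg)
  exact hc (V 𝔭) (Finset.mem_insert_of_mem (Finset.mem_image_of_mem _
    (hfin.mem_toFinset.mpr h𝔭))) hmem

open CategoryTheory Abelian

universe u

variable {R : Type u} [CommRing R] [IsNoetherianRing R] {𝔞 : Ideal R} {n j : ℕ}

theorem not_le_of_mem_associatedPrimes
    (hN : ∀ i < n, Subsingleton (Ext (ModuleCat.of R (R ⧸ 𝔞)) (ModuleCat.of R R) i))
    {q : ℕ → R} (hj : j < n) (hq : IsRegularSeq q j) {𝔭 : Ideal R}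
    (h𝔭 : 𝔭 ∈ associatedPrimes R (R ⧸ Ideal.span (q '' Set.Iio j))) : ¬𝔞 ≤ 𝔭 := by
  intro h
  obtain ⟨hprime, x, hx⟩ := isAssociatedPrime_iff.mp h𝔭
  obtain ⟨u, rfl⟩ := Ideal.Quotient.mk_surjective x
  have hu : u ∈ Ideal.span (q '' Set.Iio j) := by
    refine mem_span_of_forall_mul_mem hj hN hq fun a ha => ?_
    have hau := h ha
    rw [hx, Submodule.mem_colon_singleton] at hau
    exact Ideal.Quotient.eq_zero_iff_mem.mp hau
  apply hprime.ne_top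
  rw [hx, Ideal.Quotient.eq_zero_iff_mem.mpr hu]
  simp

theorem exists_linearIndependent_isRegularSeq [Algebra K R] {p : Fin n → R}
    (hN : ∀ i < n, Subsingleton (Ext (ModuleCat.of R (R ⧸ 𝔞)) (ModuleCat.of R R) i))
    (hp : 𝔞 ≤ (Ideal.span (Set.range p)).radical) (hj : j ≤ n) :
    ∃ c : ℕ → Fin n → K, LinearIndependent K (fun i : Fin j => c i) ∧
      IsRegularSeq (fun i => Fintype.linearCombination K p (c i)) j := by
  induction j with
  | zero => exact ⟨0, linearIndependent_empty_type, fun i hi => (Nat.not_lt_zero i hi).elim⟩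
  | succ j ih =>
    obtain ⟨c, hc, hreg⟩ := ih (Nat.le_of_succ_le hj)
    have hspan : Submodule.span K (Set.range fun i : Fin j => c i) ≠ ⊤ := by
      intro htop
      have h := finrank_span_eq_card hc
      rw [htop, finrank_top, Module.finrank_fin_fun, Fintype.card_fin] at h
      omega
    set I := Ideal.span ((fun i => Fintype.linearCombination K p (c i)) '' Set.Iio j)
    have hassoc : ∀ 𝔭 ∈ associatedPrimes R (R ⧸ I), ∃ l, p l ∉ 𝔭 := by
      intro 𝔭 h𝔭
      by_contra! h
      have hprime : 𝔭.IsPrime := IsAssociatedPrime.isPrime h𝔭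
      refine not_le_of_mem_associatedPrimes hN hj hreg h𝔭 (hp.trans ?_)
      exact hprime.radical_le_iff.mpr (Ideal.span_le.mpr (Set.range_subset_iff.mpr h))
    obtain ⟨v, hv, hregv⟩ := exists_linearCombination_isSMulRegular hassoc hspan
    refine ⟨Function.update c j v, linearIndependent_update hc hv, ?_⟩
    have hcongr (i : ℕ) (hi : i < j) : Fintype.linearCombination K p (Function.update c j v i) =
        Fintype.linearCombination K p (c i) := by
      rw [Function.update_of_ne hi.ne]
    intro i hi
    rcases Nat.lt_succ_iff_lt_or_eq.mp hi with hij | rfl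
    · exact (isRegularSeq_congr hcongr).mpr hreg i hij
    · beta_reduce
      rw [Set.image_congr (s := Set.Iio i) hcongr, Function.update_self]
      exact hregv

end PrimeAvoidance

section Variables

open MvPolynomial RingTheory.Sequence CategoryTheory Abelian

theorem ofList_take_ofFn {A : Type*} [CommRing A] {n : ℕ} (f : Fin n → A) (i : ℕ) :
    Ideal.ofList ((List.ofFn f).take i) = Ideal.span (f '' {k : Fin n | (k : ℕ) < i}) := by
  rw [Ideal.ofList]
  congr 1
  ext a
  simp only [Set.mem_ofPred_eq, List.mem_take_iff_getElem, Set.mem_image, List.getElem_ofFn,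
    List.length_ofFn]
  constructor
  · rintro ⟨k, hk, rfl⟩
    exact ⟨⟨k, by omega⟩, by simp; omega, rfl⟩
  · rintro ⟨k, hk, rfl⟩
    exact ⟨k, by omega, rfl⟩

theorem isSMulRegular_X_quotient_span_X {σ R : Type*} [CommRing R] {s : Set σ} {i : σ}
    (hi : i ∉ s) :
    IsSMulRegular (MvPolynomial σ R ⧸ Ideal.span (X '' s : Set (MvPolynomial σ R)))
      (X i : MvPolynomial σ R) := by
  rw [isSMulRegular_quotient_iff_mem_of_smul_mem]
  intro u hu
  rw [smul_eq_mul, mem_ideal_span_X_image] at hu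
  rw [mem_ideal_span_X_image]
  intro x hx
  obtain ⟨k, hk, hxk⟩ := hu (Finsupp.single i 1 + x) (by
    rw [mem_support_iff, coeff_X_mul]
    exact mem_support_iff.mp hx)
  have hik : i ≠ k := fun h => hi (h ▸ hk)
  exact ⟨k, hk, by simpa [Finsupp.single_apply, hik] using hxk⟩

universe u

variable {n : ℕ}

theorem isRegular_ofFn_X {R : Type*} [CommRing R] [Nontrivial R] :
    IsRegular (MvPolynomial (Fin n) R) (List.ofFn (X : Fin n → MvPolynomial (Fin n) R)) := by
  refine ⟨⟨fun i hi => ?_⟩, ?_⟩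
  · rw [ofList_take_ofFn, List.getElem_ofFn, smul_eq_mul, Ideal.mul_top]
    exact isSMulRegular_X_quotient_span_X (lt_irrefl i)
  · rw [← List.take_of_length_le (l := List.ofFn X) (i := n) (by simp), ofList_take_ofFn,
      smul_eq_mul, Ideal.mul_top]
    intro h
    have h₁ := h.le (Submodule.mem_top (x := (1 : MvPolynomial (Fin n) R)))
    obtain ⟨i, -, hi⟩ := mem_ideal_span_X_image.mp h₁ 0 (by simp)
    exact hi rfl

theorem subsingleton_ext_quotient_idealOfVars {R : Type u} [CommRing R] [Nontrivial R]
    [IsNoetherianRing R] :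
    ∀ i < n, Subsingleton (Ext
      (ModuleCat.of (MvPolynomial (Fin n) R) (MvPolynomial (Fin n) R ⧸ idealOfVars (Fin n) R))
      (ModuleCat.of (MvPolynomial (Fin n) R) (MvPolynomial (Fin n) R)) i) := by
  have hlist : Ideal.ofList (List.ofFn (X : Fin n → MvPolynomial (Fin n) R)) =
      idealOfVars (Fin n) R := by
    rw [← List.take_of_length_le (l := List.ofFn X) (i := n) (by simp), ofList_take_ofFn]
    simp [idealOfVars]
  have hlt : idealOfVars (Fin n) R • (⊤ : Ideal (MvPolynomial (Fin n) R)) < ⊤ := by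
    rw [lt_top_iff_ne_top, ← hlist]
    exact isRegular_ofFn_X.top_ne_smul.symm
  have h := ModuleCat.subsingleton_ext_of_exists_isRegular (idealOfVars (Fin n) R)
    (ModuleCat.of _ (MvPolynomial (Fin n) R ⧸ idealOfVars (Fin n) R))
    (by rw [Module.support_eq_zeroLocus, Ideal.annihilator_quotient])
    (ModuleCat.of _ (MvPolynomial (Fin n) R)) hlt _
    (fun r hr => hlist ▸ Ideal.subset_span hr) isRegular_ofFn_X
  rwa [List.length_ofFn] at h

theorem finrank_quotient_span_range_sup_pow {K : Type u} [Field K] [Infinite K] {m N : ℕ}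
    {p G : Fin n → MvPolynomial (Fin n) K} (hG : ∀ i, HasLeadingForm m (G i) (p i))
    (hp : idealOfVars (Fin n) K ≤ (Ideal.span (Set.range p)).radical) (hN : n * m < N) :
    Module.finrank K
      (MvPolynomial (Fin n) K ⧸ Ideal.span (Set.range G) ⊔ idealOfVars (Fin n) K ^ N) =
        m ^ n := by
  obtain ⟨c, hc, hreg⟩ :=
    exists_linearIndependent_isRegularSeq (K := K) subsingleton_ext_quotient_idealOfVars hp le_rfl
  have hspan : Submodule.span K (c '' Set.Iio n) = ⊤ := by
    rw [← hc.span_eq_top_of_card_eq_finrank' (by simp)]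
    congr 1
    ext v
    simp [Fin.exists_iff]
  rw [← span_linearCombination_eq hspan G, finrank_quotient_span_sup_pow
    (fun i => HasLeadingForm.linearCombination hG (c i)) le_rfl hreg,
    ncard_boundedExponents_self hN]

end Variables

section FormalNeighbourhood

open MvPolynomial

theorem exists_mem_sub_mem_mul_map {R A : Type*} [CommRing R] [CommRing A] {ι : R →+* A}
    {I : Ideal A} (hι : ∀ a, ∃ q, a - ι q ∈ I) {J : Ideal R} {b : A} (hb : b ∈ J.map ι) :
    ∃ v ∈ J, b - ι v ∈ I * J.map ι := by
  rw [Ideal.map, Ideal.span] at hb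
  induction hb using Submodule.closure_induction with
  | zero => exact ⟨0, zero_mem _, by simp⟩
  | add x y _ _ hx hy =>
    obtain ⟨v, hv, hxv⟩ := hx
    obtain ⟨w, hw, hyw⟩ := hy
    refine ⟨v + w, add_mem hv hw, ?_⟩
    rw [map_add, add_sub_add_comm]
    exact add_mem hxv hyw
  | smul_mem a x hx =>
    obtain ⟨w, hw, rfl⟩ := hx
    obtain ⟨q, hq⟩ := hι a
    refine ⟨q * w, Ideal.mul_mem_left _ _ hw, ?_⟩
    rw [map_mul, smul_eq_mul, ← sub_mul]
    exact Ideal.mul_mem_mul hq (Ideal.mem_map_of_mem ι hw)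

theorem exists_pow_le_of_finite_quotient {K A : Type*} [Field K] [CommRing A] [Algebra K A]
    {M I : Ideal A} (hM : M ≤ Ideal.jacobson ⊥) [Module.Finite K (A ⧸ I)] : ∃ k, M ^ k ≤ I := by
  have : IsArtinianRing (A ⧸ I) := IsArtinianRing.of_finite K (A ⧸ I)
  obtain ⟨k, hk⟩ := IsArtinianRing.isNilpotent_jacobson_bot (R := A ⧸ I)
  refine ⟨k, ?_⟩
  have hle : M.map (Ideal.Quotient.mk I) ≤ Ideal.jacobson ⊥ := by
    rw [Ideal.map_le_iff_le_comap, Ideal.comap_jacobson_of_surjective Ideal.Quotient.mk_surjective]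
    exact hM.trans (Ideal.jacobson_mono bot_le)
  have h := Ideal.pow_right_mono hle k
  rwa [hk, ← Ideal.map_pow, Ideal.zero_eq_bot, le_bot_iff, Ideal.map_eq_bot_iff_le_ker,
    Ideal.mk_ker] at h

variable {σ K A : Type*} [Field K] [CommRing A] [Algebra K A]

/-- `A` has the same formal neighbourhood as the origin of the affine space over `K` with
coordinates `σ`: the map `ι` induces an isomorphism from formal power series to the completion of
`A` at the ideal generated by the coordinates. -/
structure IsFormalNeighbourhood (ι : MvPolynomial σ K →ₐ[K] A) : Prop where
  map_le_jacobson : (idealOfVars σ K).map ι ≤ Ideal.jacobson ⊥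
  exists_sub_algebraMap_mem : ∀ a, ∃ c : K, a - algebraMap K A c ∈ (idealOfVars σ K).map ι
  mem_pow_of_map_mem : ∀ q k, ι q ∈ (idealOfVars σ K).map ι ^ k → q ∈ idealOfVars σ K ^ k

local notation "𝔪" => idealOfVars σ K

theorem span_eq_map_span_sup_pow {κ : Type*} {N : ℕ} {F : κ → A} {G : κ → MvPolynomial σ K}
    {ι : MvPolynomial σ K →ₐ[K] A}
    (hN : Ideal.map ι 𝔪 ^ N ≤ Ideal.span (Set.range F))
    (hG : ∀ i, F i - ι (G i) ∈ Ideal.map ι 𝔪 ^ N) :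
    Ideal.span (Set.range F) = Ideal.map ι (Ideal.span (Set.range G) ⊔ 𝔪 ^ N) := by
  rw [Ideal.map_sup, Ideal.map_pow, Ideal.map_span, ← Set.range_comp]
  apply le_antisymm
  · rw [Ideal.span_le]
    rintro _ ⟨i, rfl⟩
    rw [← add_sub_cancel (ι (G i)) (F i)]
    exact add_mem (Ideal.mem_sup_left (Ideal.subset_span ⟨i, rfl⟩)) (Ideal.mem_sup_right (hG i))
  · refine sup_le (Ideal.span_le.mpr ?_) hN
    rintro _ ⟨i, rfl⟩
    rw [Function.comp_apply, ← sub_sub_cancel (F i) (ι (G i))]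
    exact sub_mem (Ideal.subset_span ⟨i, rfl⟩) (hN (hG i))

namespace IsFormalNeighbourhood

variable {ι : MvPolynomial σ K →ₐ[K] A} (h : IsFormalNeighbourhood ι)

include h

theorem exists_sub_mem_pow (k : ℕ) (a : A) : ∃ q, a - ι q ∈ Ideal.map ι 𝔪 ^ k := by
  have hone (b : A) : ∃ q, b - ι q ∈ Ideal.map ι 𝔪 := by
    obtain ⟨c, hc⟩ := h.exists_sub_algebraMap_mem b
    exact ⟨algebraMap K _ c, by rwa [AlgHom.commutes]⟩
  induction k with
  | zero => exact ⟨0, by simp⟩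
  | succ k ih =>
    obtain ⟨q, hq⟩ := ih
    rw [← Ideal.map_pow] at hq
    obtain ⟨r, -, hr⟩ := exists_mem_sub_mem_mul_map (ι := (ι : MvPolynomial σ K →+* A)) hone hq
    refine ⟨q + r, ?_⟩
    rw [pow_succ', ← Ideal.map_pow, map_add, ← sub_sub]
    exact hr

theorem comap_map_eq {J : Ideal (MvPolynomial σ K)} {N : ℕ} (hJ : 𝔪 ^ N ≤ J) :
    (J.map ι).comap ι = J := by
  refine le_antisymm (fun u hu => ?_) Ideal.le_comap_map
  obtain ⟨v, hv, huv⟩ := exists_mem_sub_mem_mul_map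
    (ι := (ι : MvPolynomial σ K →+* A)) (h.exists_sub_mem_pow N) (Ideal.mem_comap.mp hu)
  have huvN : u - v ∈ 𝔪 ^ N := by
    apply h.mem_pow_of_map_mem
    rw [map_sub]
    exact Ideal.mul_le_left (J := J.map ι) huv
  rw [← sub_add_cancel u v]
  exact add_mem (hJ huvN) hv

theorem bijective_quotientMapₐ {J : Ideal (MvPolynomial σ K)} {N : ℕ} (hJ : 𝔪 ^ N ≤ J) :
    Function.Bijective (Ideal.quotientMapₐ (J.map ι) ι Ideal.le_comap_map) := by
  refine ⟨Ideal.quotientMap_injective' (H := Ideal.le_comap_map) (h.comap_map_eq hJ).le,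
    fun x => ?_⟩
  obtain ⟨a, rfl⟩ := Ideal.Quotient.mk_surjective x
  obtain ⟨q, hq⟩ := h.exists_sub_mem_pow N a
  refine ⟨Ideal.Quotient.mk J q, (Ideal.Quotient.eq.mpr ?_).symm⟩
  rw [← Ideal.map_pow] at hq
  exact Ideal.map_mono hJ hq

variable {κ : Type*} {m k : ℕ} {p : κ → MvPolynomial σ K}

theorem pow_idealOfVars_le_span (hp : ∀ i, (p i).IsHomogeneous m)
    (hk : Ideal.map ι 𝔪 ^ k ≤ Ideal.span (Set.range fun i => ι (p i))) :
    𝔪 ^ k ≤ Ideal.span (Set.range p) := by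
  set J := Ideal.span (Set.range p) ⊔ 𝔪 ^ (k + 1 + m)
  have hJ : 𝔪 ^ k ≤ J := by
    rw [← h.comap_map_eq (J := J) le_sup_right, ← Ideal.map_le_iff_le_comap, Ideal.map_pow]
    refine hk.trans (Ideal.span_le.mpr ?_)
    rintro _ ⟨i, rfl⟩
    exact Ideal.mem_map_of_mem ι (Ideal.mem_sup_left (Ideal.subset_span ⟨i, rfl⟩))
  rw [pow_idealOfVars_eq_span, Ideal.span_le]
  rintro _ ⟨x, hx, rfl⟩
  have hhom : (monomial x (1 : K)).IsHomogeneous k := isHomogeneous_monomial _ hx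
  exact mem_span_of_mem_sup_pow (Set.forall_mem_range.mpr hp) hhom
    (hJ (mem_pow_idealOfVars_of_isHomogeneous hhom))

variable {F : κ → A}

theorem map_pow_le_span [Finite σ] (hp : ∀ i, (p i).IsHomogeneous m)
    (hk : 𝔪 ^ k ≤ Ideal.span (Set.range p))
    (hF : ∀ i, F i - ι (p i) ∈ Ideal.map ι 𝔪 ^ (m + 1)) :
    Ideal.map ι 𝔪 ^ k ≤ Ideal.span (Set.range F) := by
  set M := Ideal.map ι 𝔪
  have hfg : M.FG := Ideal.FG.map (idealOfVars_fg σ K) ι.toRingHom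
  have hpow : 𝔪 ^ k ≤ 𝔪 ^ (k - m) * Ideal.span (Set.range p) := fun u hu =>
    span_inf_pow_le_mul_span k (Set.forall_mem_range.mpr hp) ⟨hk hu, hu⟩
  have hspan : (Ideal.span (Set.range p)).map ι ≤ Ideal.span (Set.range F) ⊔ M ^ (m + 1) := by
    rw [Ideal.map_span, Ideal.span_le]
    rintro _ ⟨_, ⟨i, rfl⟩, rfl⟩
    exact Submodule.mem_sup.mpr ⟨F i, Ideal.subset_span ⟨i, rfl⟩, -(F i - ι (p i)),
      neg_mem (hF i), by simp⟩
  have hnakayama : M ^ k ≤ Ideal.span (Set.range F) ⊔ M * M ^ k :=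
    calc M ^ k
        ≤ M ^ (k - m) * (Ideal.span (Set.range p)).map ι := by
          simpa only [Ideal.map_mul, Ideal.map_pow] using Ideal.map_mono (f := ι) hpow
      _ ≤ M ^ (k - m) * (Ideal.span (Set.range F) ⊔ M ^ (m + 1)) := Ideal.mul_mono_right hspan
      _ ≤ Ideal.span (Set.range F) ⊔ M * M ^ k := by
          rw [Ideal.mul_sup, ← pow_add, ← pow_succ']
          exact sup_le_sup Ideal.mul_le_right (Ideal.pow_le_pow_right (by omega))
  exact Submodule.le_of_le_smul_of_le_jacobson_bot hfg.pow h.map_le_jacobson hnakayama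

end IsFormalNeighbourhood

theorem IsFormalNeighbourhood.rank_quotient_span {K A : Type*} [Field K] [Infinite K] [CommRing A]
    [Algebra K A] {n m : ℕ} {ι : MvPolynomial (Fin n) K →ₐ[K] A} (h : IsFormalNeighbourhood ι)
    {p : Fin n → MvPolynomial (Fin n) K} (hp : ∀ i, (p i).IsHomogeneous m)
    [Module.Finite K (A ⧸ Ideal.span (Set.range fun i => ι (p i)))]
    {F : Fin n → A} (hF : ∀ i, F i - ι (p i) ∈ (idealOfVars (Fin n) K).map ι ^ (m + 1)) :
    Module.rank K (A ⧸ Ideal.span (Set.range F)) = (m ^ n : ℕ) := by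
  obtain ⟨k, hk⟩ := exists_pow_le_of_finite_quotient (K := K)
    (I := Ideal.span (Set.range fun i => ι (p i))) h.map_le_jacobson
  have hkp := h.pow_idealOfVars_le_span hp hk
  have hkF := h.map_pow_le_span hp hkp hF
  obtain ⟨N, hNk, hNm, hNn⟩ : ∃ N, k ≤ N ∧ m + 1 ≤ N ∧ n * m < N :=
    ⟨k + (m + 1) + n * m, by omega, by omega, by omega⟩
  choose G hG using fun i => h.exists_sub_mem_pow N (F i)
  have hGp (i : Fin n) : HasLeadingForm m (G i) (p i) := by
    refine ⟨hp i, h.mem_pow_of_map_mem _ _ ?_⟩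
    have hsub := sub_mem (hF i) (Ideal.pow_le_pow_right hNm (hG i))
    rwa [sub_sub_sub_cancel_left, ← map_sub] at hsub
  set J := Ideal.span (Set.range G) ⊔ idealOfVars (Fin n) K ^ N
  have hFJ : Ideal.span (Set.range F) = J.map ι :=
    span_eq_map_span_sup_pow ((Ideal.pow_le_pow_right hNk).trans hkF) hG
  have hfin : Module.Finite K (MvPolynomial (Fin n) K ⧸ J) :=
    .of_surjective (Ideal.Quotient.factorₐ K le_sup_right).toLinearMap
      (Ideal.Quotient.factor_surjective (le_sup_right (b := idealOfVars (Fin n) K ^ N)))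
  let e := AlgEquiv.ofBijective _ (h.bijective_quotientMapₐ (J := J) le_sup_right)
  have : Module.Finite K (A ⧸ J.map ι) := .equiv e.toLinearEquiv
  rw [hFJ, ← Module.finrank_eq_rank, ← e.toLinearEquiv.finrank_eq,
    finrank_quotient_span_range_sup_pow hGp ?_ hNn]
  exact fun x hx => ⟨k, hkp (Ideal.pow_mem_pow hx k)⟩

end FormalNeighbourhood

section Hadamard

open MeasureTheory

theorem contDiff_integral_zero_one {E : Type*} [NormedAddCommGroup E] [NormedSpace ℝ E]
    {G : E × ℝ → ℝ} (hG : ContDiff ℝ ∞ G) :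
    ContDiff ℝ ∞ fun x => ∫ t in (0 : ℝ)..1, G (x, t) := by
  -- With a bump function `χ` equal to `1` on `[-2, 2]`, the integral is the convolution at `0` of
  -- the indicator of `(0, 1]` with the compactly supported function `t ↦ χ t * G (x, -t)`.
  let χ : ContDiffBump (0 : ℝ) := ⟨2, 3, by norm_num, by norm_num⟩
  have hindicator : LocallyIntegrable (Set.indicator (Set.Ioc (0 : ℝ) 1) fun _ => (1 : ℝ)) :=
    ((integrable_indicator_iff measurableSet_Ioc).mpr
      (integrableOn_const (by simp) (by simp))).locallyIntegrable
  have hχG : ContDiff ℝ ∞ fun y : E × ℝ => χ y.2 * G (y.1, -y.2) :=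
    (χ.contDiff.comp contDiff_snd).mul (hG.comp (contDiff_fst.prodMk contDiff_snd.neg))
  have hconv := contDiffOn_convolution_right_with_param_comp (n := ⊤) (μ := volume)
    (ContinuousLinearMap.mul ℝ ℝ) (v := fun _ : E => (0 : ℝ)) contDiffOn_const
    (g := fun x t => χ t * G (x, -t)) isOpen_univ (isCompact_closedBall (0 : ℝ) 3)
    (fun x t _ ht => by
      simp only [χ.zero_of_le_dist (le_of_lt (by simpa using ht)), zero_mul])
    hindicator hχG.contDiffOn
  rw [contDiffOn_univ] at hconv
  convert hconv using 2 with x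
  rw [intervalIntegral.integral_of_le zero_le_one, ← integral_indicator measurableSet_Ioc]
  simp only [convolution, ContinuousLinearMap.mul_apply', zero_sub, neg_neg]
  refine integral_congr_ae (Eventually.of_forall fun t => ?_)
  by_cases ht : t ∈ Set.Ioc (0 : ℝ) 1
  · have hχ : χ (-t) = 1 := χ.one_of_mem_closedBall (by
      rw [Metric.mem_closedBall, dist_zero_right, norm_neg, Real.norm_eq_abs, abs_of_pos ht.1]
      exact ht.2.trans (by norm_num))
    simp [ht, hχ]
  · simp [ht]

variable {n : ℕ}

theorem IsSmoothGerm.exists_contDiff {f : RSpace n → ℝ} (hf : IsSmoothGerm f) :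
    ∃ F : RSpace n → ℝ, ContDiff ℝ ∞ F ∧ F =ᶠ[𝓝 0] f := by
  obtain ⟨r, hr, hball⟩ := Metric.eventually_nhds_iff_ball.mp hf
  let χ : ContDiffBump (0 : RSpace n) := ⟨r / 3, r / 2, by positivity, by linarith⟩
  refine ⟨fun x => χ x * f x, contMDiff_iff_contDiff.mp (contMDiff_of_tsupport fun x hx => ?_), ?_⟩
  · have hxr : x ∈ Metric.ball 0 r := by
      refine Metric.closedBall_subset_ball (half_lt_self hr) ?_
      rw [← χ.tsupport_eq]
      exact tsupport_mul_subset_left hx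
    exact (χ.contDiffAt.mul (hball x hxr)).contMDiffAt
  · filter_upwards [χ.eventuallyEq_one] with x hx
    simp [hx]

theorem sub_eq_sum_mul_integral_fderiv {F : RSpace n → ℝ} (hF : ContDiff ℝ ∞ F) (x : RSpace n) :
    F x - F 0 =
      ∑ i, x i * ∫ t in (0 : ℝ)..1, fderiv ℝ F (t • x) (EuclideanSpace.single i 1) := by
  have hcont (v : RSpace n) : Continuous fun t : ℝ => fderiv ℝ F (t • x) v :=
    ((hF.continuous_fderiv (by simp)).comp (continuous_id.smul continuous_const)).clm_apply
      continuous_const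
  have hsum (t : ℝ) :
      fderiv ℝ F (t • x) x = ∑ i, x i * fderiv ℝ F (t • x) (EuclideanSpace.single i 1) := by
    have hx : ∑ i, x i • EuclideanSpace.single i (1 : ℝ) = x := by
      simpa using (EuclideanSpace.basisFun (Fin n) ℝ).sum_repr x
    exact (congrArg _ hx).symm.trans (by simp)
  have hFTC : F x = F 0 + ∫ t in (0 : ℝ)..1, fderiv ℝ F (t • x) x := by
    simpa using map_add_eq_sum_add_integral_iteratedFDeriv (f := F) (x := 0) (y := x) (n := 0)
      fun t _ => hF.contDiffAt.of_le (by norm_cast)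
  rw [sub_eq_iff_eq_add'.mpr hFTC]
  simp only [hsum, ← intervalIntegral.integral_const_mul]
  exact intervalIntegral.integral_finsetSum fun i _ =>
    (continuous_const.mul (hcont _)).intervalIntegrable _ _

/-- **Hadamard's lemma**. -/
theorem IsSmoothGerm.exists_sub_eq_sum_mul {f : RSpace n → ℝ} (hf : IsSmoothGerm f) :
    ∃ g : Fin n → RSpace n → ℝ, (∀ i, IsSmoothGerm (g i)) ∧
      (fun x => f x - f 0) =ᶠ[𝓝 0] fun x => ∑ i, x i * g i x := by
  obtain ⟨F, hF, hFf⟩ := hf.exists_contDiff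
  refine ⟨fun i x => ∫ t in (0 : ℝ)..1, fderiv ℝ F (t • x) (EuclideanSpace.single i 1),
    fun i => ?_, ?_⟩
  · have hG : ContDiff ℝ ∞ fun y : RSpace n × ℝ =>
        fderiv ℝ F (y.2 • y.1) (EuclideanSpace.single i 1) :=
      ((hF.fderiv_right (by simp)).comp (contDiff_snd.smul contDiff_fst)).clm_apply contDiff_const
    exact Eventually.of_forall fun x => (contDiff_integral_zero_one hG).contDiffAt
  · filter_upwards [hFf] with x hx
    rw [← hx, ← hFf.self_of_nhds, sub_eq_sum_mul_integral_fderiv hF]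

end Hadamard

section GermAlgebra

open MvPolynomial

variable {n : ℕ}

theorem IsSmoothGerm.continuousAt {f : RSpace n → ℝ} (hf : IsSmoothGerm f) : ContinuousAt f 0 :=
  hf.self_of_nhds.continuousAt

theorem IsSmoothGerm.add {f g : RSpace n → ℝ} (hf : IsSmoothGerm f) (hg : IsSmoothGerm g) :
    IsSmoothGerm (f + g) := by
  filter_upwards [hf, hg] with x hfx hgx using hfx.add hgx

theorem IsSmoothGerm.sub {f g : RSpace n → ℝ} (hf : IsSmoothGerm f) (hg : IsSmoothGerm g) :
    IsSmoothGerm (f - g) := by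
  filter_upwards [hf, hg] with x hfx hgx using hfx.sub hgx

theorem isSmoothGerm_coord (i : Fin n) : IsSmoothGerm fun x : RSpace n => x i :=
  Eventually.of_forall fun _ => (EuclideanSpace.proj (𝕜 := ℝ) i).contDiff.contDiffAt

theorem isSmoothGerm_eval (q : MvPolynomial (Fin n) ℝ) :
    IsSmoothGerm fun x : RSpace n => eval x.ofLp q := by
  refine Eventually.of_forall fun x => ContDiff.contDiffAt ?_
  induction q using MvPolynomial.induction_on with
  | C a => simpa using contDiff_const
  | add p q hp hq => simpa using hp.add hq
  | mul_X p i hp => simpa using hp.mul (EuclideanSpace.proj (𝕜 := ℝ) i).contDiff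

theorem exists_isSmoothGerm_germ_eq (a : smoothGerms n) :
    ∃ (f : RSpace n → ℝ) (hf : IsSmoothGerm f), hf.germ = a := by
  obtain ⟨_, f, hf, rfl⟩ := a
  exact ⟨f, hf, rfl⟩

theorem coe_algebraMap_smoothGerms (c : ℝ) :
    (algebraMap ℝ (smoothGerms n) c : Germ (𝓝 (0 : RSpace n)) ℝ) = Germ.ofFun fun _ => c := by
  change algebraMap ℝ (Germ (𝓝 (0 : RSpace n)) ℝ) c = _
  rw [Algebra.algebraMap_eq_smul_one]
  exact congrArg Germ.ofFun (funext fun x => by simp)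

/-- The map sending a polynomial to the germ at `0` of its polynomial function. -/
noncomputable def polyGerm (n : ℕ) : MvPolynomial (Fin n) ℝ →ₐ[ℝ] smoothGerms n :=
  aeval fun i => (isSmoothGerm_coord i).germ

theorem polyGerm_eq_germ (q : MvPolynomial (Fin n) ℝ) :
    polyGerm n q = (isSmoothGerm_eval q).germ := by
  apply Subtype.ext
  induction q using MvPolynomial.induction_on with
  | C a =>
    rw [← MvPolynomial.algebraMap_eq, AlgHom.commutes, coe_algebraMap_smoothGerms]
    exact congrArg Germ.ofFun (funext fun x => by simp)
  | add p q hp hq =>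
    rw [map_add, AddMemClass.coe_add, hp, hq]
    exact congrArg Germ.ofFun (funext fun x => by simp)
  | mul_X p i hp =>
    rw [map_mul, MulMemClass.coe_mul, hp, polyGerm, aeval_X]
    exact congrArg Germ.ofFun (funext fun x => by simp)

/-- The maximal ideal of `𝓔ₙ`, presented as the ideal generated by the coordinates. -/
noncomputable abbrev coordIdeal (n : ℕ) : Ideal (smoothGerms n) :=
  (idealOfVars (Fin n) ℝ).map (polyGerm n)

theorem germ_coord_mem_coordIdeal (i : Fin n) : (isSmoothGerm_coord i).germ ∈ coordIdeal n := by
  rw [← aeval_X (R := ℝ) (fun j : Fin n => (isSmoothGerm_coord j).germ) i]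
  exact Ideal.mem_map_of_mem (polyGerm n) (Ideal.subset_span ⟨i, rfl⟩)

theorem coordIdeal_le {I : Ideal (smoothGerms n)} (h : ∀ i, (isSmoothGerm_coord i).germ ∈ I) :
    coordIdeal n ≤ I := by
  rw [Ideal.map_le_iff_le_comap, Ideal.span_le]
  rintro _ ⟨i, rfl⟩
  rw [SetLike.mem_coe, Ideal.mem_comap, polyGerm, aeval_X]
  exact h i

theorem germ_sub_algebraMap_mem_coordIdeal {f : RSpace n → ℝ} (hf : IsSmoothGerm f) :
    hf.germ - algebraMap ℝ _ (f 0) ∈ coordIdeal n := by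
  obtain ⟨g, hg, hfg⟩ := hf.exists_sub_eq_sum_mul
  have hsum : hf.germ - algebraMap ℝ _ (f 0) =
      ∑ i, (hg i).germ * (isSmoothGerm_coord i).germ := by
    apply Subtype.ext
    rw [AddSubgroupClass.coe_sub, coe_algebraMap_smoothGerms, AddSubmonoidClass.coe_finsetSum]
    change _ = ∑ i, Germ.coeRingHom (𝓝 (0 : RSpace n)) fun x => g i x * x i
    rw [← map_sum]
    refine Germ.coe_eq.mpr (hfg.trans (Eventually.of_forall fun x => ?_))
    simp [mul_comm]
  rw [hsum]
  exact sum_mem fun i _ => Ideal.mul_mem_left _ _ (germ_coord_mem_coordIdeal i)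

/-- The ideal of smooth germs that are `O(‖x‖ ^ k)`. -/
noncomputable def orderIdeal (n k : ℕ) : Ideal (smoothGerms n) where
  carrier := {a | ∃ f : RSpace n → ℝ, (a : Germ (𝓝 (0 : RSpace n)) ℝ) = f ∧
    f =O[𝓝 0] fun x => ‖x‖ ^ k}
  zero_mem' := ⟨0, rfl, isBigO_zero _ _⟩
  add_mem' := by
    rintro a b ⟨f, hf, hf'⟩ ⟨g, hg, hg'⟩
    exact ⟨f + g, by rw [AddMemClass.coe_add, hf, hg]; rfl, hf'.add hg'⟩
  smul_mem' := by
    rintro c a ⟨f, hf, hf'⟩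
    obtain ⟨g, hg, rfl⟩ := exists_isSmoothGerm_germ_eq c
    refine ⟨g * f, by rw [smul_eq_mul, MulMemClass.coe_mul, hf]; rfl, ?_⟩
    have hg1 : g =O[𝓝 0] fun _ => (1 : ℝ) := hg.continuousAt.isBigO_one ℝ
    simpa using! hg1.mul hf'

theorem IsSmoothGerm.germ_mem_orderIdeal {f : RSpace n → ℝ} (hf : IsSmoothGerm f) {k : ℕ} :
    hf.germ ∈ orderIdeal n k ↔ f =O[𝓝 0] fun x => ‖x‖ ^ k := by
  constructor
  · rintro ⟨g, hg, hg'⟩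
    exact (Germ.coe_eq.mp hg).trans_isBigO hg'
  · exact fun h => ⟨f, rfl, h⟩

theorem coordIdeal_pow_le_orderIdeal (k : ℕ) : coordIdeal n ^ k ≤ orderIdeal n k := by
  have hone : coordIdeal n ≤ orderIdeal n 1 := by
    refine coordIdeal_le fun i => (isSmoothGerm_coord i).germ_mem_orderIdeal.mpr ?_
    refine IsBigO.of_bound 1 (Eventually.of_forall fun x => ?_)
    simpa using PiLp.norm_apply_le x i
  induction k with
  | zero =>
    intro a _
    obtain ⟨f, hf, rfl⟩ := exists_isSmoothGerm_germ_eq a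
    rw [hf.germ_mem_orderIdeal]
    simpa using hf.continuousAt.isBigO_one ℝ
  | succ k ih =>
    rw [pow_succ, Ideal.mul_le]
    intro a ha b hb
    obtain ⟨f, hf, hf'⟩ := ih ha
    obtain ⟨g, hg, hg'⟩ := hone hb
    refine ⟨f * g, by rw [MulMemClass.coe_mul, hf, hg]; rfl, ?_⟩
    simpa [pow_succ] using! hf'.mul hg'

theorem IsSmoothGerm.isBigO_of_germ_mem {f : RSpace n → ℝ} (hf : IsSmoothGerm f) {k : ℕ}
    (h : hf.germ ∈ coordIdeal n ^ k) : f =O[𝓝 0] fun x => ‖x‖ ^ k :=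
  hf.germ_mem_orderIdeal.mp (coordIdeal_pow_le_orderIdeal k h)

theorem IsSmoothGerm.isUnit_germ {f : RSpace n → ℝ} (hf : IsSmoothGerm f) (h0 : f 0 ≠ 0) :
    IsUnit hf.germ := by
  have hne : ∀ᶠ x in 𝓝 0, f x ≠ 0 := hf.continuousAt.eventually_ne h0
  have hinv : IsSmoothGerm f⁻¹ := by
    filter_upwards [hf, hne] with x hx hx0 using hx.inv hx0
  refine IsUnit.of_mul_eq_one hinv.germ (Subtype.ext (Germ.coe_eq.mpr ?_))
  filter_upwards [hne] with x hx using mul_inv_cancel₀ hx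

theorem coordIdeal_le_jacobson : coordIdeal n ≤ Ideal.jacobson ⊥ := by
  intro a ha
  rw [Ideal.mem_jacobson_bot]
  intro b
  obtain ⟨f, hf, hfab⟩ := exists_isSmoothGerm_germ_eq (a * b)
  have hmem : hf.germ ∈ coordIdeal n ^ 1 := by
    rw [hfab, pow_one]
    exact Ideal.mul_mem_right _ _ ha
  have hf0 : f 0 = 0 := (hf.isBigO_of_germ_mem hmem).eq_zero_imp.self_of_nhds (by simp)
  have hone : IsSmoothGerm (1 : RSpace n → ℝ) := Eventually.of_forall fun _ => contDiffAt_const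
  rw [← hfab]
  exact (hf.add hone).isUnit_germ (by simp [hf0])

end GermAlgebra

section Order

open MvPolynomial

theorem sub_homogeneousComponent_mem {σ R : Type*} [CommRing R] {d : ℕ} {u : MvPolynomial σ R}
    (hu : u ∈ idealOfVars σ R ^ d) : u - homogeneousComponent d u ∈ idealOfVars σ R ^ (d + 1) := by
  classical
  rw [mem_pow_idealOfVars_iff'] at hu ⊢
  intro x hx
  rw [coeff_sub, coeff_homogeneousComponent]
  split_ifs with h
  · exact sub_self _
  · rw [hu x (by omega), sub_zero]

theorem eval_smul_of_isHomogeneous {σ R : Type*} [CommSemiring R] {q : MvPolynomial σ R} {d : ℕ}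
    (hq : q.IsHomogeneous d) (t : R) (x : σ → R) : eval (t • x) q = t ^ d * eval x q := by
  rw [eval_eq, eval_eq, Finset.mul_sum]
  refine Finset.sum_congr rfl fun a ha => ?_
  have hdeg : ∑ i ∈ a.support, a i = d := by
    rw [← Finsupp.degree_apply, Finsupp.degree_eq_weight_one]
    exact hq (mem_support_iff.mp ha)
  simp only [Pi.smul_apply, smul_eq_mul, mul_pow, Finset.prod_mul_distrib,
    Finset.prod_pow_eq_pow_sum, hdeg]
  ring

theorem tendsto_apply_smul_div_pow {E : Type*} [NormedAddCommGroup E] [NormedSpace ℝ E]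
    {u : E → ℝ} {k : ℕ} (hu : u =o[𝓝 0] fun x => ‖x‖ ^ k) (x : E) :
    Tendsto (fun t : ℝ => u (t • x) / t ^ k) (𝓝[>] 0) (𝓝 0) := by
  have hsmul : Tendsto (fun t : ℝ => t • x) (𝓝[>] 0) (𝓝 0) := by
    have hcont : Continuous fun t : ℝ => t • x := continuous_id.smul continuous_const
    simpa using (hcont.tendsto 0).mono_left nhdsWithin_le_nhds
  have hbound : (fun t : ℝ => ‖t • x‖ ^ k) =O[𝓝[>] 0] fun t => t ^ k :=
    IsBigO.of_bound (‖x‖ ^ k) (Eventually.of_forall fun t => by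
      simp [norm_smul, mul_pow, mul_comm])
  exact ((hu.comp_tendsto hsmul).trans_isBigO hbound).tendsto_div_nhds_zero

variable {n : ℕ}

theorem eq_zero_of_isHomogeneous_of_isLittleO {q : MvPolynomial (Fin n) ℝ} {d : ℕ}
    (hq : q.IsHomogeneous d)
    (ho : (fun x : RSpace n => eval x.ofLp q) =o[𝓝 0] fun x => ‖x‖ ^ d) : q = 0 := by
  refine MvPolynomial.funext fun x => ?_
  have hconst : Tendsto (fun _ : ℝ => eval x q) (𝓝[>] 0) (𝓝 0) := by
    refine (tendsto_apply_smul_div_pow ho (WithLp.toLp 2 x)).congr' ?_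
    filter_upwards [self_mem_nhdsWithin] with t ht
    rw [WithLp.ofLp_smul, eval_smul_of_isHomogeneous hq,
      mul_div_cancel_left₀ _ (pow_ne_zero d (Set.mem_Ioi.mp ht).ne')]
  rw [map_zero, tendsto_nhds_unique tendsto_const_nhds hconst]

theorem isBigO_eval_of_mem_pow {q : MvPolynomial (Fin n) ℝ} {k : ℕ}
    (hq : q ∈ idealOfVars (Fin n) ℝ ^ k) :
    (fun x : RSpace n => eval x.ofLp q) =O[𝓝 0] fun x => ‖x‖ ^ k := by
  apply (isSmoothGerm_eval q).isBigO_of_germ_mem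
  rw [← polyGerm_eq_germ, ← Ideal.map_pow]
  exact Ideal.mem_map_of_mem _ hq

theorem mem_pow_idealOfVars_of_isLittleO {q : MvPolynomial (Fin n) ℝ} {k : ℕ}
    (hq : (fun x : RSpace n => eval x.ofLp q) =o[𝓝 0] fun x => ‖x‖ ^ k) :
    q ∈ idealOfVars (Fin n) ℝ ^ (k + 1) := by
  have hmem : q ∈ idealOfVars (Fin n) ℝ ^ k := by
    cases k with
    | zero => simp
    | succ k =>
      exact mem_pow_idealOfVars_of_isLittleO
        (hq.trans (isLittleO_norm_pow_norm_pow k.lt_succ_self))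
  have hrest := sub_homogeneousComponent_mem hmem
  have ho : (fun x : RSpace n => eval x.ofLp (homogeneousComponent k q)) =o[𝓝 0]
      fun x => ‖x‖ ^ k := by
    simpa using hq.sub
      ((isBigO_eval_of_mem_pow hrest).trans_isLittleO (isLittleO_norm_pow_norm_pow k.lt_succ_self))
  rwa [eq_zero_of_isHomogeneous_of_isLittleO (homogeneousComponent_isHomogeneous k q) ho,
    sub_zero] at hrest

theorem isFormalNeighbourhood_polyGerm (n : ℕ) : IsFormalNeighbourhood (polyGerm n) where
  map_le_jacobson := coordIdeal_le_jacobson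
  exists_sub_algebraMap_mem a := by
    obtain ⟨f, hf, rfl⟩ := exists_isSmoothGerm_germ_eq a
    exact ⟨f 0, germ_sub_algebraMap_mem_coordIdeal hf⟩
  mem_pow_of_map_mem q k hq := by
    cases k with
    | zero => simp
    | succ k =>
      rw [polyGerm_eq_germ] at hq
      exact mem_pow_idealOfVars_of_isLittleO (((isSmoothGerm_eval q).isBigO_of_germ_mem hq
        ).trans_isLittleO (isLittleO_norm_pow_norm_pow k.lt_succ_self))

theorem IsSmoothGerm.germ_mem_pow_iff {f : RSpace n → ℝ} (hf : IsSmoothGerm f) {k : ℕ} :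
    hf.germ ∈ coordIdeal n ^ (k + 1) ↔ f =o[𝓝 0] fun x => ‖x‖ ^ k := by
  have hlt := isLittleO_norm_pow_norm_pow (E' := RSpace n) k.lt_succ_self
  refine ⟨fun h => (hf.isBigO_of_germ_mem h).trans_isLittleO hlt, fun ho => ?_⟩
  obtain ⟨q, hq⟩ := (isFormalNeighbourhood_polyGerm n).exists_sub_mem_pow (k + 1) hf.germ
  have hfq : (f - fun x => eval x.ofLp q) =O[𝓝 0] fun x : RSpace n => ‖x‖ ^ (k + 1) := by
    rw [polyGerm_eq_germ] at hq
    exact (hf.sub (isSmoothGerm_eval q)).isBigO_of_germ_mem hq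
  have hqo : (fun x : RSpace n => eval x.ofLp q) =o[𝓝 0] fun x => ‖x‖ ^ k := by
    simpa using ho.sub (hfq.trans_isLittleO hlt)
  rw [← sub_add_cancel hf.germ (polyGerm n q)]
  refine add_mem hq ?_
  rw [← Ideal.map_pow]
  exact Ideal.mem_map_of_mem _ (mem_pow_idealOfVars_of_isLittleO hqo)

end Order

section PartialDerivatives

open MvPolynomial

theorem derivation_mem_pow {R A : Type*} [CommRing R] [CommRing A] [Algebra R A]
    (D : Derivation R A A) {I : Ideal A} {k : ℕ} {a : A} (ha : a ∈ I ^ (k + 1)) :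
    D a ∈ I ^ k := by
  induction k generalizing a with
  | zero => simp
  | succ k ih =>
    rw [pow_succ'] at ha
    induction ha using Submodule.mul_induction_on' with
    | mem_mul_mem x hx y hy =>
      rw [D.leibniz, smul_eq_mul, smul_eq_mul]
      refine add_mem ?_ (Ideal.mul_mem_right _ _ hy)
      rw [pow_succ']
      exact Ideal.mul_mem_mul hx (ih hy)
    | add x _ y _ hx hy =>
      rw [map_add]
      exact add_mem hx hy

variable {n : ℕ}

theorem partialD_eventuallyEq (i : Fin n) {f g : RSpace n → ℝ} (h : f =ᶠ[𝓝 0] g) :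
    partialD i f =ᶠ[𝓝 0] partialD i g := by
  filter_upwards [h.fderiv (𝕜 := ℝ)] with x hx
  simp [partialD, hx]

theorem IsSmoothGerm.eventually_differentiableAt {f : RSpace n → ℝ} (hf : IsSmoothGerm f) :
    ∀ᶠ x in 𝓝 0, DifferentiableAt ℝ f x := by
  filter_upwards [hf] with x hx using hx.differentiableAt (by simp)

/-- The partial derivative `∂/∂xᵢ` as a derivation of `𝓔ₙ`. -/
noncomputable def germPartialD (i : Fin n) : Derivation ℝ (smoothGerms n) (smoothGerms n) :=
  Derivation.mk'
    { toFun a := ⟨Germ.map' (partialD i) (fun _ _ => partialD_eventuallyEq i) a.1, by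
        obtain ⟨f, hf, rfl⟩ := exists_isSmoothGerm_germ_eq a
        exact ⟨partialD i f, hf.partialD i, rfl⟩⟩
      map_add' a b := by
        obtain ⟨f, hf, rfl⟩ := exists_isSmoothGerm_germ_eq a
        obtain ⟨g, hg, rfl⟩ := exists_isSmoothGerm_germ_eq b
        refine Subtype.ext (Germ.coe_eq.mpr ?_)
        filter_upwards [hf.eventually_differentiableAt, hg.eventually_differentiableAt]
          with x hfx hgx
        change partialD i (f + g) x = partialD i f x + partialD i g x
        simp [partialD, fderiv_add hfx hgx]
      map_smul' c a := by
        obtain ⟨f, hf, rfl⟩ := exists_isSmoothGerm_germ_eq a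
        refine Subtype.ext (Germ.coe_eq.mpr ?_)
        filter_upwards [hf.eventually_differentiableAt] with x hfx
        change partialD i (c • f) x = c • partialD i f x
        simp [partialD, fderiv_const_smul hfx] }
    fun a b => by
      obtain ⟨f, hf, rfl⟩ := exists_isSmoothGerm_germ_eq a
      obtain ⟨g, hg, rfl⟩ := exists_isSmoothGerm_germ_eq b
      refine Subtype.ext (Germ.coe_eq.mpr ?_)
      filter_upwards [hf.eventually_differentiableAt, hg.eventually_differentiableAt] with x hfx hgx
      change partialD i (f * g) x = f x * partialD i g x + g x * partialD i f x
      simp [partialD, fderiv_mul hfx hgx]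

theorem germPartialD_germ (i : Fin n) {f : RSpace n → ℝ} (hf : IsSmoothGerm f) :
    germPartialD i hf.germ = (hf.partialD i).germ :=
  rfl

theorem germPartialD_polyGerm (i : Fin n) (q : MvPolynomial (Fin n) ℝ) :
    germPartialD i (polyGerm n q) = polyGerm n (pderiv i q) := by
  induction q using MvPolynomial.induction_on with
  | C a => rw [pderiv_C, map_zero, ← algebraMap_eq, AlgHom.commutes, Derivation.map_algebraMap]
  | add p q hp hq => simp only [map_add, hp, hq]
  | mul_X p j hp =>
    have hX : germPartialD i (polyGerm n (X j)) = polyGerm n (pderiv i (X j)) := by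
      rw [polyGerm, aeval_X, germPartialD_germ, ← polyGerm, polyGerm_eq_germ]
      refine Subtype.ext (Germ.coe_eq.mpr (Eventually.of_forall fun x => ?_))
      have hproj : fderiv ℝ (fun x : RSpace n => x j) x = EuclideanSpace.proj (𝕜 := ℝ) j :=
        (EuclideanSpace.proj (𝕜 := ℝ) j).fderiv
      simp [partialD, hproj, pderiv_X, Pi.single_apply]
    simp only [map_mul, Derivation.leibniz, map_add, smul_eq_mul, hp, hX]

end PartialDerivatives

section InitialParts

open MvPolynomial

variable {n : ℕ}

theorem isLittleO_norm_rpow_norm_rpow {E : Type*} [NormedAddCommGroup E] {α β : ℝ} (hα : 0 ≤ α)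
    (h : α < β) : (fun x : E => ‖x‖ ^ β) =o[𝓝 0] fun x => ‖x‖ ^ α := by
  have hzero : Tendsto (fun x : E => ‖x‖ ^ (β - α)) (𝓝 0) (𝓝 0) := by
    simpa [Real.zero_rpow (sub_pos.mpr h).ne'] using
      (continuous_norm.rpow_const fun _ => Or.inr (sub_pos.mpr h).le).tendsto (0 : E)
  refine (((isLittleO_one_iff ℝ).mpr hzero).mul_isBigO (isBigO_refl (fun x : E => ‖x‖ ^ α) _)).congr
    (fun x => ?_) fun x => one_mul _
  rw [← Real.rpow_add_of_nonneg (norm_nonneg x) (sub_pos.mpr h).le hα, sub_add_cancel]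

/-- `Q` is the initial form of `f` at `0`: the nonzero homogeneous part, of degree `d`, of lowest
degree of its Taylor series. -/
structure IsInitialForm (f : RSpace n → ℝ) (d : ℕ) (Q : MvPolynomial (Fin n) ℝ) : Prop where
  isHomogeneous : Q.IsHomogeneous d
  ne_zero : Q ≠ 0
  isLittleO_sub : (fun x => f x - eval x.ofLp Q) =o[𝓝 0] fun x => ‖x‖ ^ d

theorem IsSmoothGerm.exists_isInitialForm {f : RSpace n → ℝ} (hf : IsSmoothGerm f)
    (h : ∃ k, hf.germ ∉ coordIdeal n ^ k) : ∃ d Q, IsInitialForm f d Q := by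
  obtain ⟨d, hmem, hnot⟩ : ∃ d, hf.germ ∈ coordIdeal n ^ d ∧ hf.germ ∉ coordIdeal n ^ (d + 1) := by
    by_contra! hstep
    obtain ⟨k, hk⟩ := h
    exact hk (Nat.rec (by simp) hstep k)
  obtain ⟨q, hq⟩ := (isFormalNeighbourhood_polyGerm n).exists_sub_mem_pow (d + 1) hf.germ
  have hqmem : q ∈ idealOfVars (Fin n) ℝ ^ d := by
    refine (isFormalNeighbourhood_polyGerm n).mem_pow_of_map_mem q d ?_
    simpa using sub_mem hmem (Ideal.pow_le_pow_right d.le_succ hq)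
  have hgerm : hf.germ - polyGerm n (homogeneousComponent d q) ∈ coordIdeal n ^ (d + 1) := by
    have hrest := Ideal.mem_map_of_mem (polyGerm n) (sub_homogeneousComponent_mem hqmem)
    rw [Ideal.map_pow, map_sub] at hrest
    simpa using add_mem hq hrest
  refine ⟨d, homogeneousComponent d q, homogeneousComponent_isHomogeneous d q,
    fun h0 => hnot ?_, ?_⟩
  · simpa [h0] using hgerm
  · rw [polyGerm_eq_germ] at hgerm
    exact (hf.sub (isSmoothGerm_eval _)).germ_mem_pow_iff.mp hgerm

namespace IsInitialForm

variable {f : RSpace n → ℝ} {d : ℕ} {Q : MvPolynomial (Fin n) ℝ}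

theorem isBigO (h : IsInitialForm f d Q) : f =O[𝓝 0] fun x => ‖x‖ ^ d := by
  simpa using h.isLittleO_sub.isBigO.add
    (isBigO_eval_of_mem_pow (mem_pow_idealOfVars_of_isHomogeneous h.isHomogeneous))

theorem not_isLittleO (h : IsInitialForm f d Q) : ¬ f =o[𝓝 0] fun x => ‖x‖ ^ d := fun ho =>
  h.ne_zero (eq_zero_of_isHomogeneous_of_isLittleO h.isHomogeneous
    (by simpa using ho.sub h.isLittleO_sub))

theorem degree_ne_zero (h : IsInitialForm f d Q) (hf : ContinuousAt f 0) (hf0 : f 0 = 0) :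
    d ≠ 0 := by
  rintro rfl
  refine h.not_isLittleO ?_
  simpa [ContinuousAt, hf0] using hf

theorem degree_le {g : RSpace n → ℝ} {e : ℕ} {P : MvPolynomial (Fin n) ℝ}
    {φ : RSpace n → RSpace n} (hf : IsInitialForm f d Q) (hg : IsInitialForm g e P)
    (hφ : φ =O[𝓝 0] (id : RSpace n → RSpace n)) (hfg : f =O[𝓝 0] (g ∘ φ)) : e ≤ d := by
  by_contra! hlt
  have hφ0 : Tendsto φ (𝓝 0) (𝓝 0) := hφ.trans_tendsto tendsto_id
  have hfe : f =O[𝓝 0] fun x => ‖x‖ ^ e :=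
    (hfg.trans (hg.isBigO.comp_tendsto hφ0)).trans (hφ.norm_norm.pow e)
  exact hf.not_isLittleO (hfe.trans_isLittleO (isLittleO_norm_pow_norm_pow hlt))

theorem tendsto_apply_smul_div_pow (h : IsInitialForm f d Q) (x : RSpace n) :
    Tendsto (fun t : ℝ => f (t • x) / t ^ d) (𝓝[>] 0) (𝓝 (eval x.ofLp Q)) := by
  have hlim := (_root_.tendsto_apply_smul_div_pow h.isLittleO_sub x).add_const (eval x.ofLp Q)
  rw [zero_add] at hlim
  refine hlim.congr' ?_
  filter_upwards [self_mem_nhdsWithin] with t ht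
  rw [WithLp.ofLp_smul, eval_smul_of_isHomogeneous h.isHomogeneous, sub_div,
    mul_div_cancel_left₀ _ (pow_ne_zero d (Set.mem_Ioi.mp ht).ne'), sub_add_cancel]

theorem eq_eval_of_homogeneous (h : IsInitialForm f d Q) {α : ℝ}
    (hf : ∀ t : ℝ, 0 < t → ∀ x, f (t • x) = t ^ α * f x) (hα : d ≤ α) :
    α = d ∧ f = fun x => eval x.ofLp Q := by
  have hlim (x : RSpace n) :
      Tendsto (fun t : ℝ => t ^ (α - d) * f x) (𝓝[>] 0) (𝓝 (eval x.ofLp Q)) := by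
    refine (h.tendsto_apply_smul_div_pow x).congr' ?_
    filter_upwards [self_mem_nhdsWithin] with t ht
    rw [hf t ht, Real.rpow_sub ht, Real.rpow_natCast, mul_div_right_comm]
  have hd : α = d := by
    by_contra! hne
    have hpos : 0 < α - d := sub_pos.mpr (hα.lt_of_ne' hne)
    have hpow : Tendsto (fun t : ℝ => t ^ (α - d)) (𝓝[>] 0) (𝓝 (0 ^ (α - d))) :=
      (Real.continuousAt_rpow_const 0 _ (Or.inr hpos.le)).tendsto.mono_left nhdsWithin_le_nhds
    refine h.ne_zero (MvPolynomial.funext fun x => ?_)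
    have hzero := hpow.mul_const (f (WithLp.toLp 2 x))
    rw [Real.zero_rpow hpos.ne', zero_mul] at hzero
    rw [map_zero]
    exact tendsto_nhds_unique (hlim (WithLp.toLp 2 x)) hzero
  subst hd
  refine ⟨rfl, funext fun x => ?_⟩
  have hconst := hlim x
  simp only [sub_self, Real.rpow_zero, one_mul] at hconst
  exact tendsto_nhds_unique tendsto_const_nhds hconst

end IsInitialForm

theorem IsInitialPart.exists_isInitialForm {f h : RSpace n → ℝ} (hfh : IsInitialPart f h)
    (hh : IsSmoothGerm h) : ∃ d Q, IsInitialForm f d Q ∧ h = fun x => eval x.ofLp Q := by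
  obtain ⟨α, hα, hhom, hno, hsub⟩ := hfh
  have hflat {k : ℕ} (hk : α < k) : ¬ h =O[𝓝 0] fun x => ‖x‖ ^ k := fun hO =>
    hno (hO.trans_isLittleO (by
      simpa only [Real.rpow_natCast] using
        isLittleO_norm_rpow_norm_rpow (E := RSpace n) hα hk))
  obtain ⟨k, hk⟩ := exists_nat_gt α
  obtain ⟨d, Q, hQ⟩ := hh.exists_isInitialForm
    ⟨k, fun hmem => hflat hk (hh.isBigO_of_germ_mem hmem)⟩
  obtain ⟨rfl, rfl⟩ := hQ.eq_eval_of_homogeneous hhom (not_lt.mp fun hlt => hflat hlt hQ.isBigO)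
  simp only [Real.rpow_natCast] at hsub
  exact ⟨d, Q, ⟨hQ.isHomogeneous, hQ.ne_zero, hsub⟩, rfl⟩

end InitialParts

section LipschitzEquivalence

variable {n : ℕ} {φ : RSpace n → RSpace n} {U V : Set (RSpace n)}

theorem IsLipeomorphism.isBigO_id (h : IsLipeomorphism φ U V) (hU : U ∈ 𝓝 0) (hφ0 : φ 0 = 0) :
    φ =O[𝓝 0] (id : RSpace n → RSpace n) := by
  obtain ⟨-, c, -, hlip⟩ := h
  refine IsBigO.of_bound c ?_
  filter_upwards [hU] with x hx
  simpa [hφ0] using (hlip x hx 0 (mem_of_mem_nhds hU)).2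

theorem IsLipeomorphism.invFunOn (h : IsLipeomorphism φ U V) :
    IsLipeomorphism (Function.invFunOn φ U) V U := by
  obtain ⟨hbij, c, hc, hlip⟩ := h
  have hinv := hbij.invOn_invFunOn
  have hbij' := hbij.symm hinv.symm
  refine ⟨hbij', c, hc, fun x hx y hy => ?_⟩
  have hxy := hlip _ (hbij'.mapsTo hx) _ (hbij'.mapsTo hy)
  rw [hinv.2 hx, hinv.2 hy, one_div, inv_mul_le_iff₀ hc] at hxy
  rw [one_div, inv_mul_le_iff₀ hc]
  exact hxy.symm

theorem AsympEquivAtZero.isTheta {F G : RSpace n → ℝ} (h : AsympEquivAtZero F G) :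
    F =Θ[𝓝 0] G := by
  obtain ⟨c₁, c₂, -, hc₂, hFG⟩ := h
  refine ⟨IsBigO.of_bound c₂⁻¹ ?_, IsBigO.of_bound c₁ (hFG.mono fun x hx => hx.2)⟩
  filter_upwards [hFG] with x hx
  rw [le_inv_mul_iff₀ hc₂]
  exact hx.1

theorem RAsympLipEquiv.exists_isBigO {f g : RSpace n → ℝ} (h : RAsympLipEquiv f g) :
    ∃ φ ψ : RSpace n → RSpace n,
      φ =O[𝓝 0] (id : RSpace n → RSpace n) ∧ ψ =O[𝓝 0] (id : RSpace n → RSpace n) ∧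
        f =O[𝓝 0] (g ∘ φ) ∧ g =O[𝓝 0] (f ∘ ψ) := by
  obtain ⟨φ, U, V, hU, hV, h0, hφ0, hφ, hfg⟩ := h
  have hinv := hφ.1.invOn_invFunOn
  have hV0 : V ∈ 𝓝 0 := hV.mem_nhds (hφ0 ▸ hφ.1.mapsTo h0)
  have hψ0 : Function.invFunOn φ U 0 = 0 := by simpa only [hφ0] using hinv.1 h0
  have hψ := hφ.invFunOn.isBigO_id hV0 hψ0
  refine ⟨φ, Function.invFunOn φ U, hφ.isBigO_id (hU.mem_nhds h0) hφ0, hψ, hfg.isTheta.1, ?_⟩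
  refine (hfg.isTheta.2.comp_tendsto (hψ.trans_tendsto tendsto_id)).congr' ?_ .rfl
  filter_upwards [hV0] with x hx
  simp only [Function.comp_apply, hinv.2 hx]

end LipschitzEquivalence

section MilnorNumber

open MvPolynomial

variable {n : ℕ}

theorem finite_of_toENat_rank_lt_top {K V : Type*} [Field K] [AddCommGroup V] [Module K V]
    (h : Cardinal.toENat (Module.rank K V) < ⊤) : Module.Finite K V :=
  Module.rank_lt_aleph0_iff.mp (Cardinal.toENat_lt_top.mp h)

theorem IsInitialForm.milnorNumber_eq_pow {f : RSpace n → ℝ} {d : ℕ} {Q : MvPolynomial (Fin n) ℝ}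
    (hfQ : IsInitialForm f (d + 1) Q) (hf : IsSmoothGerm f)
    (hQ : AlgIsolatedSing fun x : RSpace n => eval x.ofLp Q) :
    milnorNumber f hf = (d ^ n : ℕ) := by
  obtain ⟨hQs, hfin⟩ := hQ
  have hpartial (i : Fin n) : (hQs.partialD i).germ = polyGerm n (pderiv i Q) := by
    rw [← germPartialD_polyGerm, polyGerm_eq_germ, germPartialD_germ]
  have hfinite : Module.Finite ℝ
      (smoothGerms n ⧸ Ideal.span (Set.range fun i => polyGerm n (pderiv i Q))) := by
    rw [milnorNumber, jacobianIdeal, funext hpartial] at hfin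
    exact finite_of_toENat_rank_lt_top hfin
  have hdiff (i : Fin n) :
      (hf.partialD i).germ - polyGerm n (pderiv i Q) ∈ coordIdeal n ^ (d + 1) := by
    have hmem : hf.germ - polyGerm n Q ∈ coordIdeal n ^ (d + 1 + 1) := by
      rw [polyGerm_eq_germ]
      exact (hf.sub (isSmoothGerm_eval Q)).germ_mem_pow_iff.mpr hfQ.isLittleO_sub
    rw [← germPartialD_germ i hf, ← germPartialD_polyGerm, ← map_sub]
    exact derivation_mem_pow _ hmem
  rw [milnorNumber, jacobianIdeal, (isFormalNeighbourhood_polyGerm n).rank_quotient_span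
    (m := d) (fun i => hfQ.isHomogeneous.pderiv) hdiff, map_natCast]

theorem theorem4p3_general {f g f₀ g₀ : RSpace n → ℝ} {φ ψ : RSpace n → RSpace n}
    (hf : IsSmoothGerm f) (hg : IsSmoothGerm g) (hf0 : f 0 = 0)
    (hf₀ : IsInitialPart f f₀) (hg₀ : IsInitialPart g g₀)
    (hf₁ : AlgIsolatedSing f₀) (hg₁ : AlgIsolatedSing g₀)
    (hφ : φ =O[𝓝 0] (id : RSpace n → RSpace n)) (hψ : ψ =O[𝓝 0] (id : RSpace n → RSpace n))
    (hfg : f =O[𝓝 0] (g ∘ φ)) (hgf : g =O[𝓝 0] (f ∘ ψ)) :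
    milnorNumber f hf = milnorNumber g hg := by
  obtain ⟨d, P, hP, rfl⟩ := hf₀.exists_isInitialForm hf₁.1
  obtain ⟨e, Q, hQ, rfl⟩ := hg₀.exists_isInitialForm hg₁.1
  obtain rfl : d = e := le_antisymm (hQ.degree_le hP hψ hgf) (hP.degree_le hQ hφ hfg)
  obtain ⟨d, rfl⟩ := Nat.exists_eq_succ_of_ne_zero (hP.degree_ne_zero hf.continuousAt hf0)
  rw [hP.milnorNumber_eq_pow hf hf₁, hQ.milnorNumber_eq_pow hg hg₁]

end MilnorNumber

theorem theorem4p3 (n : ℕ) (f g : RSpace n → ℝ)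
    (hf : IsSmoothGerm f) (hg : IsSmoothGerm g) (hf0 : f 0 = 0) (hg0 : g 0 = 0)
    (f₀ g₀ : RSpace n → ℝ)
    (hf₀ : IsInitialPart f f₀) (hg₀ : IsInitialPart g g₀)
    (hf₁ : AlgIsolatedSing f₀) (hg₁ : AlgIsolatedSing g₀)
    (hfg : RAsympLipEquiv f g) :
    milnorNumber f hf = milnorNumber g hg := by
  obtain ⟨φ, ψ, hφ, hψ, hO, hO'⟩ := hfg.exists_isBigO
  exact theorem4p3_general hf hg hf0 hf₀ hg₀ hf₁ hg₁ hφ hψ hO hO'
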